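/- **Setting.** A program has program points $\mathcal N$ with start point $u_0$, local variables $\mathcal X\ni\mathsf{self}$, globals $\mathcal G$, a finite set $\mathsf M$ of mutexes, and control-flow edges $(u,A,v)$ whose actions are guards/computations on locals, $x=\mathsf{create}(u_1)$, $\mathsf{lock}(a)$, $\mathsf{unlock}(a)$, $g=x$ and $x=g$. Each global $g$ has its own dedicated mutex $m_g$; accesses are atomic: each access $A$ to $g$ occurs as $\mathsf{lock}(m_g);A;\mathsf{unlock}(m_g)$, and $m_g$ is acquired only immediately before an access to $g$. Call $S\subseteq\mathsf M$ *appropriate* for $u$ if $(u,S)$ is obtained from $(u_0,\emptyset)$ by following control-flow edges, where $\mathsf{lock}(a)$ requires $a\notin S$ and leads to $S\cup\{a\}$, $\mathsf{unlock}(a)$ requires $a\in S$ and leads to $S\setminus\{a\}$, all other actions keep $S$, and $x=\mathsf{create}(u_1)$ additionally yields $(u_1,\emptyset)$. For each $g$ a set $\mathcal M[g]\ni m_g$ is given with $\mathcal M[g]\subseteq S$ for every edge $(u,g=x,v)$ and every $S$ appropriate for $u$. $\mathcal D$ is a complete lattice. Stores are maps $\sigma:\mathcal X\cup\mathcal G\to\mathcal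 D$. A constraint $x\sqsupseteq f_x$ maps an assignment $\eta$ of values to unknowns to a collection of side-effects $y\mapsto d$ and a value $d_x$; $\eta$ is a (post-)solution if always $d\sqsubseteq\eta\,y$ and $d_x\sqsubseteq\eta\,x$. In the systems below there is, for each edge $(u,A,v)$ and each $S$ appropriate for $u$ at which $A$ is allowed, one constraint for $[v,S']$, where $S'$ is the lockset after $A$. Guards and local computations act on the locals in $\sigma$ by given monotone functions, the same in all systems. Unmentioned components are unchanged and unmentioned side-effects absent. **$\mathcal C_1$ (Protection-Based Reading).** Unknowns $[u,S]$ with values $(P,\sigma)$, $P\subseteq\mathcal G$ ordered by $\supseteq$, and $[g],[g]'$ with values in $\mathcal D$. Initially $[u_0,\emptyset]\sqsupseteq(\emptyset,\sigma_0)$ with $\sigma_0\,x=\top$, $\sigma_0\,g=\bot$. Let $(P,\sigma)=\eta[u,S]$. - $x=\mathsf{create}(u_1)$: with $i=\nu_1\,u\,(P,\sigma)\,u_1$ ($\nu_1$ monotone in the state), set $x$ to $i$; side-effect $[u_1,\emptyset]\mapsto(\emptyset,\sigma\oplus(\{\mathsf{self}\mapsto i\}\cup\{g\mapsto\bot\mid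 g\in\mathcal G\}))$. - $\mathsf{lock}(a)$: no change. - $\mathsf{unlock}(b)$: $P$ becomes $\{g\in P\mid (S\setminus\{b\})\cap\mathcal M[g]\neq\emptyset\}$. Side-effects: if $b=m_g$ then $[g]'\mapsto\sigma\,g$, and also $[g]\mapsto\sigma\,g$ if $\mathcal M[g]=\{m_g\}$; if $b$ is not a dedicated mutex, $[g]\mapsto\sigma\,g$ for all $g$ with $b\in\mathcal M[g]$. - $g=x$: $(P\cup\{g\},\sigma\oplus\{g\mapsto\sigma\,x\})$. - $x=g$: $x$ receives $\sigma\,g$ if $g\in P$; otherwise $\sigma\,g\sqcup\eta[g]'$ if $S\cap\mathcal M[g]=\{m_g\}$; otherwise $\sigma\,g\sqcup\eta[g]$. **$\mathcal C_1'$.** As $\mathcal C_1$, with these additional side-effects of $\mathsf{unlock}(b)$: $[g]\mapsto\sigma\,g$ for all $g$ with $\mathcal M[g]\setminus\{m_g\}\not\subseteq S\setminus\{b\}$; and $[g]'\mapsto\sigma\,g$ for all $g$ if $b$ is a dedicated mutex, respectively for all $g$ with $b\notin\mathcal M[g]$ if it is not. **$\mathcal C_3$ (Write-Centered Reading).** Unknowns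 $[u,S]$ with values $(W,P,\sigma)$, where $W,P$ map globals to upward-closed subsets of $2^{\mathsf M}$ (ordered by inclusion, denoted by generators), and $[g,a,S,w]$ ($g\in\mathcal G$, $a\in\mathsf M$, $S,w\subseteq\mathsf M$) with values in $\mathcal D$. Initially $[u_0,\emptyset]\sqsupseteq(g\mapsto\emptyset,\ g\mapsto\{\emptyset\},\ \sigma_0)$. Let $(W,P,\sigma)=\eta[u,S]$. - $x=\mathsf{create}(u_1)$: with $i=\nu_3\,u\,(W,P,\sigma)\,u_1$, set $x$ to $i$; side-effect $[u_1,\emptyset]\mapsto(g\mapsto\emptyset,\ g\mapsto\{\emptyset\},\ \sigma\oplus(\{\mathsf{self}\mapsto i\}\cup\{g\mapsto\bot\mid g\in\mathcal G\}))$. - $\mathsf{lock}(a)$: no change. - $\mathsf{unlock}(a)$: $P\,g$ becomes $P\,g\sqcup\{S\setminus\{a\}\}$ for every $g$; side-effects $[g,a,S\setminus\{a\},w]\mapsto\sigma\,g$ for all $g$ and all minimal $w\in W\,g$. - $g=x$: $W\,g$ and $P\,g$ become $\{S\}$, $\sigma\,g$ becomes $\sigma\,x$. - $x=g$: $x$ receives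 $\sigma\,g\sqcup\bigsqcup\{\eta[g,a,S',w]\mid a\in S,\ S\cap S'=\emptyset,\ \exists S''\in P\,g: S''\cap w=\emptyset,\ \exists S'''\in P\,g: a\notin S'''\}$. **Relating them.** Let $\gamma(P,\sigma)=(W',P',\sigma)$ with $W'\,g=\{\mathcal M[g]\}$ and $P'\,g=\{\{a\}\mid a\in\mathcal M[g]\}$ if $g\in P$, $P'\,g=\{\emptyset\}$ otherwise. The two analyses use the same abstract thread ids, at least in that $\nu_3\,u\,(\gamma\,q)\,u_1\sqsubseteq\nu_1\,u\,q\,u_1$ for all $u,q,u_1$. For $\mathcal M[g]\subseteq w$ define the description relation by: $[g,a,S,w]\,\mathcal R\,[g]$ if $a\in\mathcal M[g]\setminus\{m_g\}$; $[g,a,S,w]\,\mathcal R\,[g]$ if $a\in\{m_g\}\cup(\mathsf M\setminus\mathcal M[g])$ and $\mathcal M[g]\setminus\{m_g\}\not\subseteq S$; $[g,a,S,w]\,\mathcal R\,[g]'$ if $a\in\{m_g\}\cup(\mathsf M\setminus\mathcal M[g])$ and $\mathcal M[g]\setminus\{m_g\}\subseteq S$. From $\eta$ over the unknowns of $\mathcal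 C_1'$ define $\eta_3[u,S]=\gamma(\eta[u,S])$, and $\eta_3[g,a,S,w]$ to be $\eta[g]'$ if $a\in\{m_g\}\cup(\mathsf M\setminus\mathcal M[g])$, $\mathcal M[g]\setminus\{m_g\}\subseteq S$ and $\mathcal M[g]\subseteq w$; $\bot$ if $\mathcal M[g]\not\subseteq w$; and $\eta[g]$ otherwise. **Local traces.** A raw trace of a thread $i$ is a finite sequence of steps along control-flow edges through configurations $(j,u_j,\sigma_j)$ with $\sigma_j\,\mathsf{self}=i$, where locks succeed and reads may yield any value. A global trace consists of one raw trace for each of finitely many thread ids, a create order $\to_c$ and a locking order $\to_a$ for each mutex $a$, such that: the reflexive-transitive closure $\le$ of program, create and locking orders is a partial order whose least element is the start $(0,u_0,\sigma)$ of the initial thread; each other thread is created, with the creator's locals and a new $\mathsf{self}$, at exactly one node from which a creating edge is (or can be) taken, each node creates at most one thread, and the new id, also stored in the variable assigned by the creating edge, is $\nu(t)$ for the creator's local trace $t$; $\to_a$ relates each $\mathsf{lock}(a)$ node to exactly one predecessor, an $\mathsf{unlock}(a)$ node or the least element, and each node has at most one successor; a thread locks only mutexes it does not hold and unlocks only mutexes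 it holds; every read of $g$ yields the value of the last write to $g$ preceding it in $\le$. A local trace is a global trace with a unique maximal node; $L_t[\bar u]$ is the set of mutexes held by the thread of node $\bar u$ at $\bar u$. **Theorem.** There is an $\eta_1'$ which is the least solution of $\mathcal C_1'$ and also the least solution of $\mathcal C_1$, and 1. $\eta_1'[g]\sqsubseteq\eta_1'[g]'$ for all $g\in\mathcal G$; 2. the mapping $\eta_3$ built from $\eta_1'$ is a post-solution of $\mathcal C_3$; 3. whenever $[g,a,S,w]\,\mathcal R\,[g]'$, then $\eta_3[g,a,S,w]\sqsubseteq\eta_1'[g]'$; 4. whenever $[g,a,S,w]\,\mathcal R\,[g]$, then $\eta_3[g,a,S,w]\sqsubseteq\eta_1'[g]$; 5. (soundness) suppose values are concretized by a monotone $\gamma_{\mathcal D}:\mathcal D\to 2^{\mathcal V}$ with $\gamma_{\mathcal D}(\top)=\mathcal V$, the abstract effects of guards and local computations are sound, and $\nu(t)\in\gamma_{\mathcal D}(\nu_1\,u\,q\,u_1)$ for every local trace $t$ that ends at the source $u$ of an edge $(u,x=\mathsf{create}(u_1),v)$ and that is described by $q$. Here a local trace $t$ ending in $(u,\sigma)$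 with lockset $S$ is described by $q=(P^\sharp,\sigma^\sharp)$, written $\gamma(q)=(W^\sharp,\hat P^\sharp,\sigma^\sharp)$, if $\sigma\,x\in\gamma_{\mathcal D}(\sigma^\sharp\,x)$ for all locals $x$; for each $g$ written by the ego thread, the value it wrote last is in $\gamma_{\mathcal D}(\sigma^\sharp\,g)$, the lockset at that write is in $W^\sharp g$, and all locksets it has held since then are in $\hat P^\sharp g$; and $\emptyset\in\hat P^\sharp g$ for every $g$ that it has not written. Then every local trace ending at $u$ with lockset $S$ is described by $\eta_1'[u,S]$; and whenever a local trace $t$ ends in $\mathsf{unlock}(a)$ with lockset $S$, its ego thread has last written $g$ with value $d$ at lockset $w_0$, and $w\supseteq w_0$, then $[g,a,S,w]\,\mathcal R\,[g]$ implies $d\in\gamma_{\mathcal D}(\eta_1'[g])$ and $[g,a,S,w]\,\mathcal R\,[g]'$ implies $d\in\gamma_{\mathcal D}(\eta_1'[g]')$. -/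

import Mathlib

universe u

namespace ConcurrentAnalysis

open scoped Classical in
/-- `override f y d` is the map `f ⊕ {y ↦ d}`. -/
noncomputable def override {A B : Type u} (f : A → B) (y : A) (d : B) : A → B :=
  fun z => if z = y then d else f z

/-! ### Side-effecting systems of constraints -/

/-- A constraint `lhs ⊒ rhs` over unknowns `U`, the unknown `x` taking values in `Val x`.
Given an assignment, the right-hand side returns a collection of side-effects `x ↦ d`
together with the contribution to the left-hand side. -/
structure Constraint (U : Type u) (Val : U → Type u) where
  lhs : U
  rhs : ((x : U) → Val x) → Set ((x : U) × Val x) × Val lhs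

/-- `η` is a solution (also called post-solution) of `C`: all side-effects and all contributions
are accounted for by `η`. -/
def IsSolution {U : Type u} {Val : U → Type u} [∀ x, PartialOrder (Val x)]
    (C : Set (Constraint U Val)) (η : (x : U) → Val x) : Prop :=
  ∀ c ∈ C, (∀ e ∈ (c.rhs η).1, e.2 ≤ η e.1) ∧ (c.rhs η).2 ≤ η c.lhs

/-- `η` is the least solution of `C`. -/
def IsLeastSolution {U : Type u} {Val : U → Type u} [∀ x, PartialOrder (Val x)]
    (C : Set (Constraint U Val)) (η : (x : U) → Val x) : Prop :=
  IsLeast {ζ : (x : U) → Val x | IsSolution C ζ} η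

/-! ### Programs

`N` program points, `X` local variables, `G` global variables, `M` mutexes,
`L` guards and assignments on local variables. -/

inductive Action (N X G M L : Type u) : Type u
  | comp (l : L)
  | create (x : X) (u₁ : N)
  | lock (a : M)
  | unlock (a : M)
  | write (g : G) (x : X)
  | read (x : X) (g : G)

namespace Action

variable {N X G M L : Type u}

/-- The action reads from or writes to the global `g`. -/
def Accesses (A : Action N X G M L) (g : G) : Prop :=
  (∃ x, A = write g x) ∨ (∃ x, A = read x g)

/-- Mutexes are not re-entrant, and only a mutex that is held may be unlocked. -/
def Enabled (A : Action N X G M L) (S : Set M) : Prop :=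
  match A with
  | lock a => a ∉ S
  | unlock a => a ∈ S
  | _ => True

/-- The lockset after the action when `S` is the lockset before it. -/
def post (A : Action N X G M L) (S : Set M) : Set M :=
  match A with
  | lock a => S ∪ {a}
  | unlock a => S \ {a}
  | _ => S

end Action

structure Program (N X G M L : Type u) where
  /-- control-flow edges -/
  edges : Set (N × Action N X G M L × N)
  /-- start point of the initial thread -/
  start : N
  /-- the local variable holding the id of the current thread -/
  self : X
  /-- the dedicated mutex of a global -/
  mtx : G → M

namespace Program

variable {N X G M L : Type u} (p : Program N X G M L)

/-- Accesses to globals are atomic: every global `g` has a mutex `mtx g` of its own, every access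
`A` to `g` occurs in the form `lock (mtx g); A; unlock (mtx g)`, and `mtx g` is acquired only
immediately before an access to `g`. -/
structure Atomic : Prop where
  inj : Function.Injective p.mtx
  before : ∀ u A v g, (u, A, v) ∈ p.edges → A.Accesses g →
    ∀ u' B, (u', B, u) ∈ p.edges → B = Action.lock (p.mtx g)
  after : ∀ u A v g, (u, A, v) ∈ p.edges → A.Accesses g →
    ∀ B v', (v, B, v') ∈ p.edges → B = Action.unlock (p.mtx g)
  not_start : ∀ u A v g, (u, A, v) ∈ p.edges → A.Accesses g →
    u ≠ p.start ∧ ∀ u' x v', (u', Action.create x u, v') ∉ p.edges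
  dedicated : ∀ u v g, (u, Action.lock (p.mtx g), v) ∈ p.edges →
    ∀ B v', (v, B, v') ∈ p.edges → B.Accesses g

/-- `S` is an appropriate lockset for the program point `u`: along control-flow edges, a thread
can arrive at `u` with lockset `S`. -/
inductive Reach : N → Set M → Prop
  | start : Reach p.start ∅
  | step {u : N} {S : Set M} {A : Action N X G M L} {v : N} :
      Reach u S → (u, A, v) ∈ p.edges → A.Enabled S → Reach v (A.post S)
  | spawn {u : N} {S : Set M} {x : X} {u₁ v : N} :
      Reach u S → (u, Action.create x u₁, v) ∈ p.edges → Reach u₁ ∅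

/-- `prot g` is a set of mutexes, containing `mtx g`, all of which are held at each write
to `g`. -/
def WriteProtects (prot : G → Set M) : Prop :=
  (∀ g, p.mtx g ∈ prot g) ∧
  ∀ u S g x v, p.Reach u S → (u, Action.write g x, v) ∈ p.edges → prot g ⊆ S

end Program

/-- Abstract values of the local variables and of the local copies of the globals. -/
abbrev Store (X G D : Type u) : Type u := X ⊕ G → D

/-- The abstract store with the value `⊤` for all locals and `⊥` for all globals. -/
def initStore (X G : Type u) {D : Type u} [CompleteLattice D] : Store X G D :=
  Sum.elim (fun _ => ⊤) (fun _ => ⊥)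

/-- The store of a created thread: `σ ⊕ ({self ↦ i} ∪ {g ↦ ⊥ | g})`. -/
noncomputable def childStore {X G D : Type u} [CompleteLattice D] (self : X)
    (σ : Store X G D) (i : D) : Store X G D :=
  Sum.elim (override (fun x => σ (Sum.inl x)) self i) (fun _ => ⊥)

/-- A guard or local computation changes the abstract values of locals only. -/
def compStore {X G D : Type u} (f : (X → D) → (X → D)) (σ : Store X G D) : Store X G D :=
  Sum.elim (f (fun x => σ (Sum.inl x))) (fun g => σ (Sum.inr g))

/-! ### Protection-Based Reading -/

/-- Unknowns `[u,S]`, `[g]` and `[g]'`. -/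
inductive PUnk (N G M : Type u) : Type u
  | pt (u : N) (S : Set M)
  | glob (g : G)
  | glob' (g : G)

/-- Pairs `(P, σ)`; the sets `P` are ordered by `⊇`. -/
abbrev PState (X G D : Type u) : Type u := (Set G)ᵒᵈ × Store X G D

@[reducible] def PVal (N X G M D : Type u) : PUnk N G M → Type u
  | .pt _ _ => PState X G D
  | .glob _ => D
  | .glob' _ => D

instance {N X G M D : Type u} [CompleteLattice D] :
    (y : PUnk N G M) → PartialOrder (PVal N X G M D y)
  | .pt _ _ => inferInstanceAs (PartialOrder (PState X G D))
  | .glob _ => inferInstanceAs (PartialOrder D)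
  | .glob' _ => inferInstanceAs (PartialOrder D)

abbrev PAssign (N X G M D : Type u) : Type u := (y : PUnk N G M) → PVal N X G M D y

section ProtectionBased

variable {N X G M L D : Type u} [CompleteLattice D]
  (p : Program N X G M L) (prot : G → Set M)
  (comp : L → (X → D) → (X → D)) (nu : N → PState X G D → N → D)

/-- Side-effects of `unlock b` at lockset `S` in the original system. -/
def unlockEff (_S : Set M) (b : M) (σ : Store X G D) : Set ((y : PUnk N G M) × PVal N X G M D y) :=
  {e | ∃ g, b = p.mtx g ∧ e = ⟨.glob' g, σ (Sum.inr g)⟩} ∪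
  {e | ∃ g, b = p.mtx g ∧ prot g = {p.mtx g} ∧ e = ⟨.glob g, σ (Sum.inr g)⟩} ∪
  {e | b ∉ Set.range p.mtx ∧ ∃ g, b ∈ prot g ∧ e = ⟨.glob g, σ (Sum.inr g)⟩}

/-- Side-effects of `unlock b` at lockset `S` in the modified system: `[g]` additionally receives
the values of all globals which are not totally protected any more, and `[g]'` those of all
globals not protected by `b` (all globals, if `b` is a dedicated mutex). -/
def unlockEff' (S : Set M) (b : M) (σ : Store X G D) : Set ((y : PUnk N G M) × PVal N X G M D y) :=
  {e | ∃ g, ¬ (prot g \ {p.mtx g} ⊆ S \ {b}) ∧ e = ⟨.glob g, σ (Sum.inr g)⟩} ∪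
  {e | ∃ g, b = p.mtx g ∧ prot g = {p.mtx g} ∧ e = ⟨.glob g, σ (Sum.inr g)⟩} ∪
  {e | b ∈ Set.range p.mtx ∧ ∃ g, e = ⟨.glob' g, σ (Sum.inr g)⟩} ∪
  {e | b ∉ Set.range p.mtx ∧ ∃ g, b ∉ prot g ∧ e = ⟨.glob' g, σ (Sum.inr g)⟩}

open scoped Classical in
/-- Right-hand side for action `A` at the unknown `[u,S]`, where `eff` gives the side-effects
of unlocking. -/
noncomputable def pRhs
    (eff : Set M → M → Store X G D → Set ((y : PUnk N G M) × PVal N X G M D y))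
    (u : N) (S : Set M) (A : Action N X G M L) (η : PAssign N X G M D) :
    Set ((y : PUnk N G M) × PVal N X G M D y) × PState X G D :=
  let P : Set G := OrderDual.ofDual (η (.pt u S)).1
  let σ : Store X G D := (η (.pt u S)).2
  match A with
  | .comp l => (∅, (OrderDual.toDual P, compStore (comp l) σ))
  | .create x u₁ =>
      let i := nu u (OrderDual.toDual P, σ) u₁
      ({⟨.pt u₁ ∅, (OrderDual.toDual ∅, childStore p.self σ i)⟩},
        (OrderDual.toDual P, override σ (Sum.inl x) i))
  | .lock _ => (∅, (OrderDual.toDual P, σ))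
  | .unlock b =>
      (eff S b σ, (OrderDual.toDual {g ∈ P | ((S \ {b}) ∩ prot g).Nonempty}, σ))
  | .write g x =>
      (∅, (OrderDual.toDual (P ∪ {g}), override σ (Sum.inr g) (σ (Sum.inl x))))
  | .read x g =>
      let d : D :=
        if g ∈ P then σ (Sum.inr g)
        else if S ∩ prot g = {p.mtx g} then σ (Sum.inr g) ⊔ η (.glob' g)
        else σ (Sum.inr g) ⊔ η (.glob g)
      (∅, (OrderDual.toDual P, override σ (Sum.inl x) d))

/-- The system with side-effects `eff` of unlocking. -/
def pSystem (eff : Set M → M → Store X G D → Set ((y : PUnk N G M) × PVal N X G M D y)) :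
    Set (Constraint (PUnk N G M) (PVal N X G M D)) :=
  {⟨.pt p.start ∅, fun _ => (∅, (OrderDual.toDual ∅, initStore X G))⟩} ∪
  {c | ∃ u S A v, p.Reach u S ∧ (u, A, v) ∈ p.edges ∧ A.Enabled S ∧
    c = ⟨.pt v (A.post S), pRhs p prot comp nu eff u S A⟩}

/-- The constraint system of Protection-Based Reading. -/
def C₁ : Set (Constraint (PUnk N G M) (PVal N X G M D)) :=
  pSystem p prot comp nu (unlockEff p prot)

/-- The modified constraint system of Protection-Based Reading. -/
def C₁' : Set (Constraint (PUnk N G M) (PVal N X G M D)) :=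
  pSystem p prot comp nu (unlockEff' p prot)

end ProtectionBased

/-! ### Write-Centered Reading -/

/-- Upward-closed sets of locksets, ordered by inclusion (`UpperSet` carries the reverse order). -/
abbrev UpLocks (M : Type u) : Type u := (UpperSet (Set M))ᵒᵈ

/-- The upward-closed set of locksets generated by `B`. -/
def upLocks {M : Type u} (B : Set (Set M)) : UpLocks M := OrderDual.toDual (upperClosure B)

/-- `S` belongs to the upward-closed set `A`. -/
def UpMem {M : Type u} (S : Set M) (A : UpLocks M) : Prop := S ∈ OrderDual.ofDual A

/-- Unknowns `[u,S]` and `[g,a,S,w]`. -/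
inductive WUnk (N G M : Type u) : Type u
  | pt (u : N) (S : Set M)
  | glob (g : G) (a : M) (S w : Set M)

/-- Triples `(W, P, σ)`. -/
abbrev WState (X G M D : Type u) : Type u := (G → UpLocks M) × (G → UpLocks M) × Store X G D

@[reducible] def WVal (N X G M D : Type u) : WUnk N G M → Type u
  | .pt _ _ => WState X G M D
  | .glob _ _ _ _ => D

instance {N X G M D : Type u} [CompleteLattice D] :
    (y : WUnk N G M) → PartialOrder (WVal N X G M D y)
  | .pt _ _ => inferInstanceAs (PartialOrder (WState X G M D))
  | .glob _ _ _ _ => inferInstanceAs (PartialOrder D)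

abbrev WAssign (N X G M D : Type u) : Type u := (y : WUnk N G M) → WVal N X G M D y

section WriteCentered

variable {N X G M L D : Type u} [CompleteLattice D]
  (p : Program N X G M L)
  (comp : L → (X → D) → (X → D)) (nu : N → WState X G M D → N → D)

/-- Right-hand side for action `A` at the unknown `[u,S]`. When unlocking, `w` ranges over the
minimal elements of `W g`. -/
noncomputable def wRhs (u : N) (S : Set M) (A : Action N X G M L) (η : WAssign N X G M D) :
    Set ((y : WUnk N G M) × WVal N X G M D y) × WState X G M D :=
  let W : G → UpLocks M := (η (.pt u S)).1
  let P : G → UpLocks M := (η (.pt u S)).2.1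
  let σ : Store X G D := (η (.pt u S)).2.2
  match A with
  | .comp l => (∅, (W, P, compStore (comp l) σ))
  | .create x u₁ =>
      let i := nu u (W, P, σ) u₁
      ({⟨.pt u₁ ∅, (fun _ => upLocks ∅, fun _ => upLocks {∅}, childStore p.self σ i)⟩},
        (W, P, override σ (Sum.inl x) i))
  | .lock _ => (∅, (W, P, σ))
  | .unlock a =>
      ({e | ∃ g w, Minimal (fun w' => UpMem w' (W g)) w ∧
          e = ⟨.glob g a (S \ {a}) w, σ (Sum.inr g)⟩},
        (W, fun g => P g ⊔ upLocks {S \ {a}}, σ))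
  | .write g x =>
      (∅, (override W g (upLocks {S}), override P g (upLocks {S}),
        override σ (Sum.inr g) (σ (Sum.inl x))))
  | .read x g =>
      let d : D := σ (Sum.inr g) ⊔
        sSup {d | ∃ a S' w, a ∈ S ∧ S ∩ S' = ∅ ∧
          (∃ S'', UpMem S'' (P g) ∧ S'' ∩ w = ∅) ∧
          (∃ S''', UpMem S''' (P g) ∧ a ∉ S''') ∧
          d = η (.glob g a S' w)}
      (∅, (W, P, override σ (Sum.inl x) d))

/-- The constraint system of Write-Centered Reading. -/
def C₃ : Set (Constraint (WUnk N G M) (WVal N X G M D)) :=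
  {⟨.pt p.start ∅, fun _ => (∅, (fun _ => upLocks ∅, fun _ => upLocks {∅}, initStore X G))⟩} ∪
  {c | ∃ u S A v, p.Reach u S ∧ (u, A, v) ∈ p.edges ∧ A.Enabled S ∧
    c = ⟨.pt v (A.post S), wRhs p comp nu u S A⟩}

end WriteCentered

/-! ### From Protection-Based to Write-Centered Reading -/

section Relating

variable {N X G M L D : Type u} (p : Program N X G M L) (prot : G → Set M)

open scoped Classical in
/-- The mapping `γ` from states `(P, σ)` to states `(W, P, σ)`. -/
noncomputable def gammaState (s : PState X G D) : WState X G M D :=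
  (fun g => upLocks {prot g},
   fun g => if g ∈ OrderDual.ofDual s.1 then upLocks {B | ∃ a ∈ prot g, B = {a}} else upLocks {∅},
   s.2)

open scoped Classical in
/-- The mapping `η₃` built from an assignment of the Protection-Based system. -/
noncomputable def eta₃ [CompleteLattice D] (η : PAssign N X G M D) : WAssign N X G M D
  | .pt u S => gammaState prot (η (.pt u S))
  | .glob g a S w =>
      if (a = p.mtx g ∨ a ∉ prot g) ∧ prot g \ {p.mtx g} ⊆ S ∧ prot g ⊆ w then η (.glob' g)
      else if ¬ prot g ⊆ w then (⊥ : D)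
      else η (.glob g)

/-- The description relation between the unknowns of the two systems. -/
inductive Describes : WUnk N G M → PUnk N G M → Prop
  | pt (u : N) (S : Set M) : Describes (.pt u S) (.pt u S)
  | own (g : G) (a : M) (S w : Set M) : prot g ⊆ w → a ∈ prot g \ {p.mtx g} →
      Describes (.glob g a S w) (.glob g)
  | released (g : G) (a : M) (S w : Set M) : prot g ⊆ w → (a = p.mtx g ∨ a ∉ prot g) →
      ¬ (prot g \ {p.mtx g} ⊆ S) → Describes (.glob g a S w) (.glob g)
  | retained (g : G) (a : M) (S w : Set M) : prot g ⊆ w → (a = p.mtx g ∨ a ∉ prot g) →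
      prot g \ {p.mtx g} ⊆ S → Describes (.glob g a S w) (.glob' g)

end Relating

/-! ### The local trace semantics -/

/-- A node `(j, u, σ)`: the `j`-th configuration of the thread `σ self`. -/
structure Node (N X V : Type u) : Type u where
  idx : ℕ
  pt : N
  st : X → V

/-- A graph of thread steps together with a create order and, for each mutex, a locking order. -/
structure Trace (N X G M L V : Type u) : Type u where
  nodes : Set (Node N X V)
  edges : Set (Node N X V × Action N X G M L × Node N X V)
  created : Node N X V → Node N X V → Prop
  locked : M → Node N X V → Node N X V → Prop

/-- The concrete meaning of a program: (possibly partial or non-deterministic) execution of guards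
and local assignments, the id of the initial thread, and the id of the thread which is created
next when the creating thread has the given local trace. -/
structure Semantics (N X G M L V : Type u) : Type u where
  exec : L → (X → V) → Set (X → V)
  initId : V
  newId : Trace N X G M L V → V

/-- Effect of an action on the locals of the executing thread, when considered in isolation. -/
def LocalStep {N X G M L V : Type u} (sem : Semantics N X G M L V) (ρ : X → V)
    (A : Action N X G M L) (ρ' : X → V) : Prop :=
  match A with
  | .comp l => ρ' ∈ sem.exec l ρ
  | .create x _ => ∃ i, ρ' = override ρ x i
  | .read x _ => ∃ d, ρ' = override ρ x d
  | _ => ρ' = ρ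

/-- A finite sequence of `len` steps; entries beyond `len` are irrelevant. -/
structure RawTrace (N X G M L V : Type u) : Type u where
  len : ℕ
  conf : ℕ → N × (X → V)
  act : ℕ → Action N X G M L

namespace RawTrace

variable {N X G M L V : Type u} (r : RawTrace N X G M L V)

def node (j : ℕ) : Node N X V := ⟨j, (r.conf j).1, (r.conf j).2⟩

def nodes : Set (Node N X V) := {n | ∃ j, j ≤ r.len ∧ n = r.node j}

def edges : Set (Node N X V × Action N X G M L × Node N X V) :=
  {e | ∃ j, j < r.len ∧ e = (r.node j, r.act j, r.node (j + 1))}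

/-- `r` is a raw trace of the thread `i`. -/
def IsRaw (p : Program N X G M L) (sem : Semantics N X G M L V) (i : V) : Prop :=
  (∀ j ≤ r.len, (r.conf j).2 p.self = i) ∧
  ∀ j < r.len, ((r.conf j).1, r.act j, (r.conf (j + 1)).1) ∈ p.edges ∧
    LocalStep sem (r.conf j).2 (r.act j) (r.conf (j + 1)).2

end RawTrace

namespace Trace

variable {N X G M L V : Type u} (p : Program N X G M L) (sem : Semantics N X G M L V)
  (t : Trace N X G M L V)

/-- Causality order. -/
def le : Node N X V → Node N X V → Prop :=
  Relation.ReflTransGen fun m n =>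
    (∃ A, (m, A, n) ∈ t.edges) ∨ t.created m n ∨ ∃ a, t.locked a m n

/-- The sub-trace of all nodes below `n`. -/
def down (n : Node N X V) : Trace N X G M L V where
  nodes := {m | m ∈ t.nodes ∧ t.le m n}
  edges := {e | e ∈ t.edges ∧ t.le e.1 n ∧ t.le e.2.2 n}
  created := fun m m' => t.created m m' ∧ t.le m n ∧ t.le m' n
  locked := fun a m m' => t.locked a m m' ∧ t.le m n ∧ t.le m' n

/-- The mutexes acquired by the thread of `n`, up to `n`, and not yet released. -/
def lockset (n : Node N X V) : Set M :=
  {a | ∃ m m', (m, Action.lock a, m') ∈ t.edges ∧ m'.st p.self = n.st p.self ∧ m'.idx ≤ n.idx ∧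
    ∀ k k', (k, Action.unlock a, k') ∈ t.edges → k'.st p.self = n.st p.self →
      m'.idx < k'.idx → ¬ k'.idx ≤ n.idx}

/-- `t` is a global trace of the program. Here, `z` is the initial node. -/
structure IsGlobal (z : Node N X V) : Prop where
  /-- finitely many threads, each with one raw trace -/
  raw : ∃ (I : Set V) (r : V → RawTrace N X G M L V), I.Finite ∧ (∀ i ∈ I, (r i).IsRaw p sem i) ∧
    t.nodes = (⋃ i ∈ I, (r i).nodes) ∧ t.edges = ⋃ i ∈ I, (r i).edges
  /-- mutexes are not re-entrant, and only released when held -/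
  enabled : ∀ m A n, (m, A, n) ∈ t.edges → A.Enabled (t.lockset p m)
  /-- causality order -/
  init : z ∈ t.nodes ∧ z.idx = 0 ∧ z.pt = p.start ∧ z.st p.self = sem.initId
  least : ∀ n ∈ t.nodes, t.le z n
  antisymm : ∀ m n, t.le m n → t.le n m → m = n
  /-- create order: a thread is created at a node where a creating edge is (or may be) taken -/
  created_dom : ∀ m s, t.created m s → m ∈ t.nodes ∧ s ∈ t.nodes ∧ s.idx = 0 ∧ s ≠ z ∧
    (∃ x v, (m.pt, Action.create x s.pt, v) ∈ p.edges) ∧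
    (∀ A n, (m, A, n) ∈ t.edges → ∃ x, A = Action.create x s.pt) ∧
    s.st = override m.st p.self (sem.newId (t.down m))
  created_unique : ∀ s ∈ t.nodes, s.idx = 0 → s ≠ z → ∃! m, t.created m s
  created_inj : ∀ m s s', t.created m s → t.created m s' → s = s'
  create_val : ∀ m x v n, (m, Action.create x v, n) ∈ t.edges →
    n.st = override m.st x (sem.newId (t.down m))
  /-- locking order -/
  locked_dom : ∀ a m n, t.locked a m n →
    (m = z ∨ ∃ k, (k, Action.unlock a, m) ∈ t.edges) ∧ ∃ k, (k, Action.lock a, n) ∈ t.edges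
  locked_unique : ∀ a k n, (k, Action.lock a, n) ∈ t.edges → ∃! m, t.locked a m n
  locked_inj : ∀ a m n n', t.locked a m n → t.locked a m n' → n = n'
  /-- a read yields the value of the last preceding write -/
  read_val : ∀ m x g n, (m, Action.read x g, n) ∈ t.edges →
    ∃ k y k', (k, Action.write g y, k') ∈ t.edges ∧ t.le k' m ∧
      (∀ l y' l', (l, Action.write g y', l') ∈ t.edges → t.le l' m → t.le k' l' → l' = k') ∧
      n.st x = k.st y

/-- `s` is the maximal node of `t`. -/
def IsSink (s : Node N X V) : Prop := s ∈ t.nodes ∧ ∀ n ∈ t.nodes, t.le n s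

/-- The action `A` is the last one executed by the ego thread, where `s` is the sink. -/
def IsLast (s : Node N X V) (A : Action N X G M L) : Prop := ∃ m, (m, A, s) ∈ t.edges

/-- `(m, g = x, n)` is the last thread-local write to `g` in `t`, where `s` is the sink. -/
def IsLastWrite (s : Node N X V) (g : G) (m : Node N X V) (x : X) (n : Node N X V) : Prop :=
  (m, Action.write g x, n) ∈ t.edges ∧ n.st p.self = s.st p.self ∧
  ∀ k y k', (k, Action.write g y, k') ∈ t.edges → k'.st p.self = s.st p.self → k'.idx ≤ n.idx

end Trace

section Soundness

variable {N X G M L V D : Type u} (p : Program N X G M L) (sem : Semantics N X G M L V)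

/-- The set of all local traces of the program. -/
def Traces : Set (Trace N X G M L V) := {t | (∃ z, t.IsGlobal p sem z) ∧ ∃ s, t.IsSink s}

/-- Local traces reaching `u` with lockset `S`. -/
def tracesAt (u : N) (S : Set M) : Set (Trace N X G M L V) :=
  {t | t ∈ Traces p sem ∧ ∃ s, t.IsSink s ∧ s.pt = u ∧ t.lockset p s = S}

/-- Local traces ending in `unlock a` with background lockset `S`, where the lockset at the last
thread-local write to `g` (if there is any) is contained in `w`. -/
def tracesGlob (g : G) (a : M) (S w : Set M) : Set (Trace N X G M L V) :=
  {t | t ∈ Traces p sem ∧ ∃ s, t.IsSink s ∧ t.IsLast s (Action.unlock a) ∧ t.lockset p s = S ∧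
    ∀ m x n, t.IsLastWrite p s g m x n → t.lockset p n ⊆ w}

/-- For each global, the lockset at the last thread-local write. -/
def betaW (t : Trace N X G M L V) (s : Node N X V) (g : G) : UpLocks M :=
  upLocks {B | ∃ m x n, t.IsLastWrite p s g m x n ∧ B = t.lockset p n}

/-- For each global, the locksets held by the ego thread since its last write to it (`{∅}` if
there is no such write). -/
def betaP (t : Trace N X G M L V) (s : Node N X V) (g : G) : UpLocks M :=
  upLocks ({B | ∃ m x n, t.IsLastWrite p s g m x n ∧
      ∃ k ∈ t.nodes, k.st p.self = s.st p.self ∧ n.idx ≤ k.idx ∧ B = t.lockset p k} ∪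
    {B | (¬ ∃ m x n, t.IsLastWrite p s g m x n) ∧ B = ∅})

/-- The values of the locals at the sink, and the values last written to the globals by the ego
thread. -/
def betaStore (t : Trace N X G M L V) (s : Node N X V) : X ⊕ G → Set V
  | .inl x => {s.st x}
  | .inr g => {d | ∃ m x n, t.IsLastWrite p s g m x n ∧ d = m.st x}

/-- Concretization of a state of Write-Centered Reading at the unknown `[u,S]`. -/
def gammaAt (conc : D → Set V) (u : N) (S : Set M) (q : WState X G M D) :
    Set (Trace N X G M L V) :=
  {t | t ∈ Traces p sem ∧ ∃ s, t.IsSink s ∧ s.pt = u ∧ t.lockset p s = S ∧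
    betaW p t s ≤ q.1 ∧ betaP p t s ≤ q.2.1 ∧ ∀ y, betaStore p t s y ⊆ conc (q.2.2 y)}

/-- Concretization of a value at the unknown `[g,a,S,w]`. -/
def gammaGlob (conc : D → Set V) (g : G) (a : M) (S w : Set M) (d : D) :
    Set (Trace N X G M L V) :=
  {t | t ∈ Traces p sem ∧ ∃ s, t.IsSink s ∧ t.IsLast s (Action.unlock a) ∧ t.lockset p s = S ∧
    ∀ m x n, t.IsLastWrite p s g m x n → m.st x ∈ conc d ∧ t.lockset p n ⊆ w}

/-- The ingredients of the analysis are sound for the concrete semantics: the concretization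
`conc` of abstract values, the abstract effect `comp` of guards and local computations, and the
abstract thread ids `nu`. -/
structure SoundIngredients [CompleteLattice D] (prot : G → Set M) (conc : D → Set V)
    (comp : L → (X → D) → (X → D)) (nu : N → PState X G D → N → D) : Prop where
  conc_mono : Monotone conc
  conc_top : conc ⊤ = Set.univ
  comp_sound : ∀ l (σ : X → D) (ρ ρ' : X → V), (∀ x, ρ x ∈ conc (σ x)) → ρ' ∈ sem.exec l ρ →
    ∀ x, ρ' x ∈ conc (comp l σ x)
  nu_sound : ∀ u S q x u₁ v, (u, Action.create x u₁, v) ∈ p.edges →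
    ∀ t ∈ gammaAt p sem conc u S (gammaState prot q), sem.newId t ∈ conc (nu u q u₁)

/-- The result `η` of Protection-Based Reading is sound w.r.t. the local trace semantics: each
local trace is described by the values of the unknowns it contributes to. -/
def SoundFor [CompleteLattice D] (prot : G → Set M) (conc : D → Set V)
    (η : PAssign N X G M D) : Prop :=
  (∀ u S, tracesAt p sem u S ⊆ gammaAt p sem conc u S (gammaState prot (η (.pt u S)))) ∧
  (∀ g a S w, Describes p prot (.glob g a S w) (.glob g : PUnk N G M) →
    tracesGlob p sem g a S w ⊆ gammaGlob p sem conc g a S w (η (.glob g))) ∧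
  (∀ g a S w, Describes p prot (.glob g a S w) (.glob' g : PUnk N G M) →
    tracesGlob p sem g a S w ⊆ gammaGlob p sem conc g a S w (η (.glob' g)))

end Soundness

end ConcurrentAnalysis

/-! All right-hand sides of `C₁` are monotone, so a least solution `η` exists as the pointwise
infimum of all solutions. The additional side-effects of `C₁'` do not change it, because minimality
yields invariants on the copy of `g` stored at `[u,S]`. That copy becomes nontrivial only at a
write, where all of `prot g` is held. While `mtx g` is held nothing needs to be known, and its
release publishes the copy to `[g]'`. Hence the copy is below `[g]'` whenever `mtx g ∉ S`. In the
same way it is below `[g]` as soon as some other mutex of `prot g` is missing from `S`. Such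
invariants are proved by truncating `η` at the claimed bound: the result is still a solution, so it
cannot lie below `η` properly (`store_le_of_preserved`). After any unlock no dedicated mutex is
held, so all additional side-effects are already accounted for. Conversely, `C₁'` subsumes `C₁`.
Lowering `[g]` to `[g] ⊓ [g]'` also preserves solutions, which gives `[g] ≤ [g]'`.

For `C₃`, the state `γ(P, σ)` has `prot g` as the only minimal element of `W g`, so every unlock
contributes to an unknown described by `[g]` or `[g]'`. At a read, the side conditions of the
write-centered system exclude exactly the contributions that the protection-based read ignores,
apart from those covered by `[g] ≤ [g]'` (`isSolution_eta₃`).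

Soundness is shown directly on traces, by induction along causality (`describedAt`). Its core is
mutual exclusion (`exists_unlock_of_mem_lockset`), which follows from the locking order of a mutex
being a single chain. If `g ∈ P` at a read, no foreign write can have intervened since the thread's
own write. Otherwise a foreign write being read has been published, by the release of `mtx g`
directly after it or by the release of a further common mutex before the read (`read_mem_conc`). -/

namespace ConcurrentAnalysis

/-! ### Point updates of maps -/

section Override

variable {A B : Type u}

@[simp] theorem override_same (f : A → B) (y : A) (d : B) : override f y d y = d := by
  simp [override]

theorem override_of_ne {f : A → B} {y z : A} {d : B} (h : z ≠ y) : override f y d z = f z := by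
  simp [override, h]

theorem override_le_override [Preorder B] {f f' : A → B} {y : A} {d d' : B}
    (hf : f ≤ f') (hd : d ≤ d') : override f y d ≤ override f' y d' := by
  intro z
  by_cases h : z = y
  · subst h; simpa using hd
  · simpa [override_of_ne h] using hf z

end Override

/-! ### Monotone systems of constraints -/

section Constraints

variable {U : Type u} {Val : U → Type u} [∀ x, PartialOrder (Val x)]

/-- The right-hand side of `c` depends monotonically on the assignment. -/
def Constraint.Mono (c : Constraint U Val) : Prop :=
  ∀ η η' : (x : U) → Val x, η ≤ η' →
    (∀ ζ : (x : U) → Val x, (∀ e ∈ (c.rhs η').1, e.2 ≤ ζ e.1) → ∀ e ∈ (c.rhs η).1, e.2 ≤ ζ e.1) ∧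
    (c.rhs η).2 ≤ (c.rhs η').2

/-- Knaster–Tarski: the pointwise infimum of all solutions is itself a solution. Infima enter as a
hypothesis since each `Val x` carries only a partial order here. -/
theorem exists_isLeastSolution (C : Set (Constraint U Val)) (hC : ∀ c ∈ C, c.Mono)
    (hglb : ∀ x (s : Set (Val x)), ∃ b, IsGLB s b) : ∃ η, IsLeastSolution C η := by
  choose inf hinf using hglb
  let η : (x : U) → Val x := fun x => inf x {d | ∃ ζ, IsSolution C ζ ∧ d = ζ x}
  have hle : ∀ ζ, IsSolution C ζ → η ≤ ζ := fun ζ hζ x => (hinf x _).1 ⟨ζ, hζ, rfl⟩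
  refine ⟨η, fun c hc => ⟨fun e he => (hinf _ _).2 ?_, (hinf _ _).2 ?_⟩, fun ζ hζ => hle ζ hζ⟩
  · rintro _ ⟨ζ, hζ, rfl⟩
    exact (hC c hc η ζ (hle ζ hζ)).1 ζ (hζ c hc).1 e he
  · rintro _ ⟨ζ, hζ, rfl⟩
    exact (hC c hc η ζ (hle ζ hζ)).2.trans (hζ c hc).2

end Constraints

/-! ### Appropriate locksets of atomic programs -/

namespace Program

variable {N X G M L : Type u} {p : Program N X G M L}

theorem Reach.mtx_mem_of_accesses (hp : p.Atomic) {u : N} {S : Set M} {A : Action N X G M L}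
    {v : N} {g : G} (h : p.Reach u S) (he : (u, A, v) ∈ p.edges) (hA : A.Accesses g) :
    p.mtx g ∈ S := by
  cases h with
  | start => exact absurd rfl (hp.not_start _ _ _ _ he hA).1
  | step h' he' _ =>
    obtain rfl := hp.before _ _ _ _ he hA _ _ he'
    simp [Action.post]
  | spawn h' he' => exact absurd he' ((hp.not_start _ _ _ _ he hA).2 _ _ _)

/-- A dedicated mutex is held only at the two points inside an atomic access: after its `lock`, and
after the access itself. All later statements on dedicated mutexes rest on this. -/
theorem Reach.edge_of_mtx_mem (hp : p.Atomic) {u : N} {S : Set M} {h : G} (hr : p.Reach u S)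
    (hh : p.mtx h ∈ S) :
    (∃ u', (u', Action.lock (p.mtx h), u) ∈ p.edges) ∨
      ∃ u' A, A.Accesses h ∧ (u', A, u) ∈ p.edges := by
  induction hr with
  | start => exact absurd hh (Set.notMem_empty _)
  | spawn => exact absurd hh (Set.notMem_empty _)
  | @step u S A v hr he hen ih =>
    by_cases hS : p.mtx h ∈ S
    · rcases ih hS with ⟨u', hu'⟩ | ⟨u', B, hB, hu'⟩
      · exact Or.inr ⟨u, A, hp.dedicated _ _ _ hu' _ _ he, he⟩
      · obtain rfl := hp.after _ _ _ _ hu' hB _ _ he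
        simp [Action.post] at hh
    · cases A <;> simp_all [Action.post]
      exact Or.inl ⟨u, he⟩

theorem Reach.eq_of_unlock (hp : p.Atomic) {u : N} {S : Set M} {b : M} {v : N} {g : G}
    (hr : p.Reach u S) (he : (u, Action.unlock b, v) ∈ p.edges) (hg : p.mtx g ∈ S) :
    b = p.mtx g := by
  rcases hr.edge_of_mtx_mem hp hg with ⟨u', hu'⟩ | ⟨u', B, hB, hu'⟩
  · rcases hp.dedicated _ _ _ hu' _ _ he with ⟨x, h⟩ | ⟨x, h⟩ <;> cases h
  · have := hp.after _ _ _ _ hu' hB _ _ he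
    injection this

/-- A held dedicated mutex must itself be the one being released. This is why every unlock may
publish all globals to `[g]'` without loss of precision. -/
theorem Reach.mtx_notMem_of_unlock (hp : p.Atomic) {u : N} {S : Set M} {b : M} {v : N}
    (hr : p.Reach u S) (he : (u, Action.unlock b, v) ∈ p.edges) (g : G) :
    p.mtx g ∉ S \ {b} :=
  fun h => h.2 (hr.eq_of_unlock hp he h.1).symm

theorem Reach.eq_of_mtx_mem_of_write (hp : p.Atomic) {u : N} {S : Set M} {g h : G} {x : X} {v : N}
    (hr : p.Reach u S) (he : (u, Action.write g x, v) ∈ p.edges) (hh : p.mtx h ∈ S) : h = g := by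
  have hA : (Action.write g x : Action N X G M L).Accesses g := Or.inl ⟨x, rfl⟩
  rcases hr.edge_of_mtx_mem hp hh with ⟨u', hu'⟩ | ⟨u', B, hB, hu'⟩
  · have := hp.before _ _ _ _ he hA _ _ hu'
    injection this with h1
    exact hp.inj h1
  · obtain rfl := hp.before _ _ _ _ he hA _ _ hu'
    rcases hB with ⟨x, h⟩ | ⟨x, h⟩ <;> cases h

/-- Some reachable edge of the program writes to `g`. -/
def Written (p : Program N X G M L) (g : G) : Prop :=
  ∃ u S x v, p.Reach u S ∧ (u, Action.write g x, v) ∈ p.edges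

/-- At a write to `g` the only dedicated mutex held is `mtx g`. For a global that is never written,
`prot g` is unconstrained above, so reachability of a write is essential. -/
theorem Written.eq_of_mtx_mem (hp : p.Atomic) {prot : G → Set M} (hprot : p.WriteProtects prot)
    {g h : G} (hw : p.Written g) (hh : p.mtx h ∈ prot g) : h = g := by
  obtain ⟨u, S, x, v, hr, he⟩ := hw
  exact hr.eq_of_mtx_mem_of_write hp he (hprot.2 _ _ _ _ _ hr he hh)

theorem Written.notMem_range (hp : p.Atomic) {prot : G → Set M} (hprot : p.WriteProtects prot)
    {g : G} {b : M} (hw : p.Written g) (hb : b ∈ prot g) (hne : b ≠ p.mtx g) :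
    b ∉ Set.range p.mtx := by
  rintro ⟨h, rfl⟩
  exact hne (congrArg _ (hw.eq_of_mtx_mem hp hprot hb))

end Program

/-! ### Least solutions of Protection-Based Reading -/

theorem compStore_mono {X G D : Type u} [Preorder D] {f : (X → D) → (X → D)} (hf : Monotone f) {σ σ' : Store X G D}
    (h : σ ≤ σ') : compStore f σ ≤ compStore f σ' := by
  rintro (x | g)
  · exact hf (fun x => h (Sum.inl x)) x
  · exact h (Sum.inr g)

section Stores

variable {X G D : Type u} [CompleteLattice D]

theorem childStore_mono {self : X} {σ σ' : Store X G D} {i i' : D} (h : σ ≤ σ') (hi : i ≤ i') :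
    childStore self σ i ≤ childStore self σ' i' := by
  rintro (x | g)
  · exact override_le_override (fun x => h (Sum.inl x)) hi x
  · exact le_rfl

end Stores

section ProtectionBased

variable {N X G M L D : Type u} [CompleteLattice D]
  {p : Program N X G M L} {prot : G → Set M}
  {comp : L → (X → D) → (X → D)} {nu : N → PState X G D → N → D}

theorem PVal.exists_isGLB (y : PUnk N G M) (s : Set (PVal N X G M D y)) : ∃ b, IsGLB s b := by
  cases y with
  | pt v S =>
    let s' : Set (PState X G D) := s
    exact ⟨(sInf s' : PState X G D), isGLB_sInf s'⟩
  | glob g =>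
    let s' : Set D := s
    exact ⟨(sInf s' : D), isGLB_sInf s'⟩
  | glob' g =>
    let s' : Set D := s
    exact ⟨(sInf s' : D), isGLB_sInf s'⟩

/-- The side-effects `eff` of unlocking consist of abstract values of globals, selected
independently of these values. -/
def EffMono
    (eff : Set M → M → Store X G D → Set ((y : PUnk N G M) × PVal N X G M D y)) : Prop :=
  ∀ S b (σ σ' : Store X G D), σ ≤ σ' → ∀ ζ : PAssign N X G M D,
    (∀ e ∈ eff S b σ', e.2 ≤ ζ e.1) → ∀ e ∈ eff S b σ, e.2 ≤ ζ e.1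

/-- Replaces the set of dependent pairs by plain inequalities in `D`, the form in which side-effects
are used from here on. -/
theorem unlockEff_bounded {S : Set M} {b : M} {σ : Store X G D} {ζ : PAssign N X G M D} :
    (∀ e ∈ unlockEff p prot S b σ, e.2 ≤ ζ e.1) ↔
      (∀ g, b = p.mtx g → σ (Sum.inr g) ≤ (ζ (.glob' g) : D)) ∧
      (∀ g, b = p.mtx g → prot g = {p.mtx g} → σ (Sum.inr g) ≤ (ζ (.glob g) : D)) ∧
      (∀ g, b ∉ Set.range p.mtx → b ∈ prot g → σ (Sum.inr g) ≤ (ζ (.glob g) : D)) := by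
  constructor
  · intro h
    refine ⟨fun g hg => h ⟨.glob' g, σ (Sum.inr g)⟩ (Or.inl (Or.inl ⟨g, hg, rfl⟩)),
      fun g hg hg' => h ⟨.glob g, σ (Sum.inr g)⟩ (Or.inl (Or.inr ⟨g, hg, hg', rfl⟩)),
      fun g hg hg' => h ⟨.glob g, σ (Sum.inr g)⟩ (Or.inr ⟨hg, g, hg', rfl⟩)⟩
  · rintro ⟨h1, h2, h3⟩ e ((⟨g, hg, rfl⟩ | ⟨g, hg, hg', rfl⟩) | ⟨hg, g, hg', rfl⟩)
    · exact h1 g hg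
    · exact h2 g hg hg'
    · exact h3 g hg hg'

theorem unlockEff'_bounded {S : Set M} {b : M} {σ : Store X G D} {ζ : PAssign N X G M D} :
    (∀ e ∈ unlockEff' p prot S b σ, e.2 ≤ ζ e.1) ↔
      (∀ g, ¬ (prot g \ {p.mtx g} ⊆ S \ {b}) → σ (Sum.inr g) ≤ (ζ (.glob g) : D)) ∧
      (∀ g, b = p.mtx g → prot g = {p.mtx g} → σ (Sum.inr g) ≤ (ζ (.glob g) : D)) ∧
      (∀ g, b ∈ Set.range p.mtx ∨ b ∉ prot g → σ (Sum.inr g) ≤ (ζ (.glob' g) : D)) := by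
  constructor
  · intro h
    refine ⟨fun g hg => h ⟨.glob g, σ (Sum.inr g)⟩ (Or.inl (Or.inl (Or.inl ⟨g, hg, rfl⟩))),
      fun g hg hg' => h ⟨.glob g, σ (Sum.inr g)⟩ (Or.inl (Or.inl (Or.inr ⟨g, hg, hg', rfl⟩))),
      fun g hg => ?_⟩
    by_cases hb : b ∈ Set.range p.mtx
    · exact h ⟨.glob' g, σ (Sum.inr g)⟩ (Or.inl (Or.inr ⟨hb, g, rfl⟩))
    · exact h ⟨.glob' g, σ (Sum.inr g)⟩ (Or.inr ⟨hb, g, hg.resolve_left hb, rfl⟩)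
  · rintro ⟨h1, h2, h3⟩ e (((⟨g, hg, rfl⟩ | ⟨g, hg, hg', rfl⟩) | ⟨hg, g, rfl⟩) | ⟨_, g, hg, rfl⟩)
    · exact h1 g hg
    · exact h2 g hg hg'
    · exact h3 g (Or.inl hg)
    · exact h3 g (Or.inr hg)

theorem unlockEff_mono : EffMono (N := N) (unlockEff (D := D) p prot) := by
  intro S b σ σ' h ζ
  rw [unlockEff_bounded, unlockEff_bounded]
  rintro ⟨h1, h2, h3⟩
  exact ⟨fun g a => (h _).trans (h1 g a), fun g a b => (h _).trans (h2 g a b),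
    fun g a b => (h _).trans (h3 g a b)⟩

variable {eff : Set M → M → Store X G D → Set ((y : PUnk N G M) × PVal N X G M D y)}

/-- Only reads need care. A larger state has a smaller `P`, so the branch can only change from the
local copy to a join containing it; the choice between `[g]'` and `[g]` depends on `S` alone. -/
theorem pRhs_mono (hcomp : ∀ l, Monotone (comp l)) (hnu : ∀ u u₁, Monotone fun q => nu u q u₁)
    (heff : EffMono eff) (u : N) (S : Set M) (A : Action N X G M L) (v : N) (S' : Set M) :
    Constraint.Mono (⟨.pt v S', pRhs p prot comp nu eff u S A⟩ :
      Constraint (PUnk N G M) (PVal N X G M D)) := by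
  intro η η' hη
  have hpt : (η (.pt u S) : PState X G D) ≤ η' (.pt u S) := hη _
  have hP : OrderDual.ofDual (η' (.pt u S)).1 ⊆ OrderDual.ofDual (η (.pt u S)).1 := hpt.1
  have hσ : (η (.pt u S)).2 ≤ (η' (.pt u S)).2 := hpt.2
  cases A with
  | comp l => exact ⟨by simp [pRhs], hP, compStore_mono (hcomp l) hσ⟩
  | create x u₁ =>
    refine ⟨?_, hP, override_le_override hσ (hnu u u₁ hpt)⟩
    intro ζ h e he
    obtain rfl : e = _ := he
    have hle : ((OrderDual.toDual ∅, childStore p.self (η (.pt u S)).2 (nu u (η (.pt u S)) u₁)) :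
        PState X G D) ≤
        (OrderDual.toDual ∅, childStore p.self (η' (.pt u S)).2 (nu u (η' (.pt u S)) u₁)) :=
      ⟨le_rfl, childStore_mono hσ (hnu u u₁ hpt)⟩
    exact hle.trans (h ⟨.pt u₁ ∅, _⟩ rfl)
  | lock a => exact ⟨by simp [pRhs], hP, hσ⟩
  | unlock b => exact ⟨heff S b _ _ hσ, fun g hg => ⟨hP hg.1, hg.2⟩, hσ⟩
  | write g x =>
    exact ⟨by simp [pRhs], Set.union_subset_union_left _ hP, override_le_override hσ (hσ _)⟩
  | read x g =>
    refine ⟨by simp [pRhs], hP, override_le_override hσ ?_⟩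
    have hg : (η (.glob g) : D) ≤ η' (.glob g) := hη (.glob g)
    have hg' : (η (.glob' g) : D) ≤ η' (.glob' g) := hη (.glob' g)
    have h0 := hσ (Sum.inr g)
    by_cases h1 : g ∈ OrderDual.ofDual (η' (.pt u S)).1
    · rw [if_pos h1, if_pos (hP h1)]; exact h0
    · rw [if_neg h1]
      by_cases h2 : S ∩ prot g = {p.mtx g}
      · rw [if_pos h2, if_pos h2]
        split_ifs
        · exact h0.trans le_sup_left
        · exact sup_le_sup h0 hg'
      · rw [if_neg h2, if_neg h2]
        split_ifs
        · exact h0.trans le_sup_left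
        · exact sup_le_sup h0 hg

theorem pSystem_mono (hcomp : ∀ l, Monotone (comp l)) (hnu : ∀ u u₁, Monotone fun q => nu u q u₁)
    (heff : EffMono eff) : ∀ c ∈ pSystem p prot comp nu eff, c.Mono := by
  rintro c (rfl | ⟨u, S, A, v, _, _, _, rfl⟩)
  · exact fun _ _ _ => ⟨fun _ h => h, le_rfl⟩
  · exact pRhs_mono hcomp hnu heff u S A v _

/-- A solution of the system accounts for the initial state and for each edge. -/
theorem isSolution_pSystem_iff {η : PAssign N X G M D} :
    IsSolution (pSystem p prot comp nu eff) η ↔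
      (OrderDual.toDual ∅, initStore X G) ≤ (η (.pt p.start ∅) : PState X G D) ∧
      ∀ u S A v, p.Reach u S → (u, A, v) ∈ p.edges → A.Enabled S →
        (∀ e ∈ (pRhs p prot comp nu eff u S A η).1, e.2 ≤ η e.1) ∧
        (pRhs p prot comp nu eff u S A η).2 ≤ (η (.pt v (A.post S)) : PState X G D) := by
  constructor
  · intro h
    exact ⟨(h _ (Or.inl rfl)).2,
      fun u S A v hr he hen => h _ (Or.inr ⟨u, S, A, v, hr, he, hen, rfl⟩)⟩
  · rintro ⟨h0, h1⟩ c (rfl | ⟨u, S, A, v, hr, he, hen, rfl⟩)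
    · exact ⟨fun e he => absurd he (Set.notMem_empty e), h0⟩
    · exact h1 u S A v hr he hen

end ProtectionBased
theorem PState.le_iff {X G D : Type u} [Preorder D] {q q' : PState X G D} :
    q ≤ q' ↔ q.1 ≤ q'.1 ∧ q.2 ≤ q'.2 := Iff.rfl

theorem WState.le_iff {X G M D : Type u} [Preorder D] {q q' : WState X G M D} :
    q ≤ q' ↔ (∀ g, q.1 g ≤ q'.1 g) ∧ (∀ g, q.2.1 g ≤ q'.2.1 g) ∧ q.2.2 ≤ q'.2.2 := Iff.rfl

/-! ### Bounds on copies of globals in the least solution -/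

section ProtectionBased

variable {N X G M L D : Type u} [CompleteLattice D]
  {p : Program N X G M L} {prot : G → Set M}
  {comp : L → (X → D) → (X → D)} {nu : N → PState X G D → N → D}
  {eff : Set M → M → Store X G D → Set ((y : PUnk N G M) × PVal N X G M D y)}

/-- `η` with the values of the globals at program points bounded by `bnd`. -/
def boundPoints (bnd : N → Set M → G → D) (η : PAssign N X G M D) : PAssign N X G M D
  | .pt u S => ((η (.pt u S)).1, Sum.elim (fun x => (η (.pt u S)).2 (Sum.inl x))
      fun g => (η (.pt u S)).2 (Sum.inr g) ⊓ bnd u S g)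
  | .glob g => η (.glob g)
  | .glob' g => η (.glob' g)

theorem boundPoints_le (bnd : N → Set M → G → D) (η : PAssign N X G M D) :
    boundPoints bnd η ≤ η := by
  rintro (⟨u, S⟩ | g | g)
  · refine PState.le_iff.2 ⟨le_rfl, ?_⟩
    rintro (x | g)
    · exact le_rfl
    · exact inf_le_left
  · exact (le_rfl : (η (.glob g) : D) ≤ _)
  · exact (le_rfl : (η (.glob' g) : D) ≤ _)

theorem le_boundPoints {bnd : N → Set M → G → D} {η : PAssign N X G M D} {u : N} {S : Set M}
    {q : PState X G D} (h : q ≤ η (.pt u S)) (hb : ∀ g, q.2 (Sum.inr g) ≤ bnd u S g) :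
    q ≤ boundPoints bnd η (.pt u S) := by
  refine ⟨h.1, ?_⟩
  rintro (x | g)
  · exact h.2 _
  · exact le_inf (h.2 _) (hb g)

/-- To bound the values of the globals at program points in the least solution, it suffices that
the bound is preserved by all edges, where only writes change these values. -/
theorem store_le_of_preserved (hcomp : ∀ l, Monotone (comp l))
    (hnu : ∀ u u₁, Monotone fun q => nu u q u₁) (heff : EffMono eff)
    (heff_glob : ∀ S b σ, ∀ e ∈ eff S b σ, ∀ u T, e.1 ≠ .pt u T)
    {η : PAssign N X G M D}
    (hη : IsLeastSolution (pSystem p prot comp nu eff) η) (bnd : N → Set M → G → D)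
    (hstep : ∀ u S A v g, p.Reach u S → (u, A, v) ∈ p.edges → A.Enabled S →
      (∀ x, A ≠ .write g x) → (η (.pt u S)).2 (Sum.inr g) ⊓ bnd u S g ≤ bnd v (A.post S) g)
    (hwrite : ∀ u S g x v, p.Reach u S → (u, .write g x, v) ∈ p.edges → bnd v S g = ⊤) :
    ∀ u S g, (η (.pt u S)).2 (Sum.inr g) ≤ bnd u S g := by
  have hsol := isSolution_pSystem_iff.1 hη.1
  -- If the truncated assignment is a solution, minimality puts `η` below it, hence below the bound.
  suffices h : IsSolution (pSystem p prot comp nu eff) (boundPoints bnd η) by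
    intro u S g
    have h1 : (η (.pt u S) : PState X G D) ≤ boundPoints bnd η (.pt u S) := hη.2 h (.pt u S)
    exact (h1.2 (Sum.inr g)).trans inf_le_right
  refine isSolution_pSystem_iff.2 ⟨le_boundPoints hsol.1 fun g => bot_le, ?_⟩
  intro u S A v hr he hen
  -- By monotonicity all contributions of the truncated assignment are below `η`. What remains is
  -- the bound at program points.
  obtain ⟨hm1, hm2⟩ := pRhs_mono (p := p) (prot := prot) hcomp hnu heff u S A v (A.post S)
    _ _ (boundPoints_le bnd η)
  have hs := hsol.2 u S A v hr he hen
  have hm1 := hm1 η hs.1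
  have hm2 : (pRhs p prot comp nu eff u S A (boundPoints bnd η)).2 ≤
    (η (.pt v (A.post S)) : PState X G D) := le_trans hm2 hs.2
  constructor
  · cases A with
    | create x u₁ =>
      intro e h
      have h' := hm1 e h
      obtain rfl : e = _ := h
      exact le_boundPoints h' fun g => bot_le
    | unlock b =>
      rintro ⟨(⟨w, T⟩ | g | g), d⟩ h
      · exact absurd rfl (heff_glob _ _ _ _ h w T)
      · exact hm1 _ h
      · exact hm1 _ h
    | comp l => exact fun e h => absurd h (Set.notMem_empty _)
    | lock a => exact fun e h => absurd h (Set.notMem_empty _)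
    | write g x => exact fun e h => absurd h (Set.notMem_empty _)
    | read x g => exact fun e h => absurd h (Set.notMem_empty _)
  · refine le_boundPoints hm2 fun g => ?_
    have hst := hstep u S A v g hr he hen
    cases A with
    | write h x =>
      by_cases hg : g = h
      · subst hg
        exact le_of_le_of_eq le_top (hwrite u S g x v hr he).symm
      · have h1 : ∀ y, (Action.write h x : Action N X G M L) ≠ .write g y := by
          intro y hy
          injection hy with h2
          exact hg h2.symm
        refine le_trans (le_of_eq ?_) (hst h1)
        have h2 : (Sum.inr g : X ⊕ G) ≠ Sum.inr h := fun hh => hg (Sum.inr.inj hh)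
        exact override_of_ne h2
    | comp l => exact hst (by simp)
    | create x u₁ =>
      exact (le_of_eq (override_of_ne (by simp))).trans (hst (by simp))
    | lock a => exact hst (by simp)
    | unlock b => exact hst (by simp)
    | read x h =>
      exact (le_of_eq (override_of_ne (by simp))).trans (hst (by simp))

theorem unlockEff_ne_pt {N X G M L D : Type u} {p : Program N X G M L} {prot : G → Set M} {S : Set M} {b : M} {σ : Store X G D}
    {e : (y : PUnk N G M) × PVal N X G M D y} (he : e ∈ unlockEff p prot S b σ) (u : N)
    (T : Set M) : e.1 ≠ .pt u T := by
  rcases he with (⟨g, _, rfl⟩ | ⟨g, _, _, rfl⟩) | ⟨_, g, _, rfl⟩ <;> simp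

/-! ### Consequences of minimality for `C₁` -/

section Least

variable (hatomic : p.Atomic) (hprot : p.WriteProtects prot) (hcomp : ∀ l, Monotone (comp l))
  (hnu : ∀ u u₁, Monotone fun q => nu u q u₁) {η : PAssign N X G M D}
  (hη : IsLeastSolution (C₁ p prot comp nu) η)

include hcomp hnu hη

-- Initial and child stores are `⊥` on globals, and only writes change a copy, so `⊥` is a preserved
-- bound.
open scoped Classical in
theorem store_eq_bot_of_not_written {u : N} {S : Set M} {g : G} (hg : ¬ p.Written g) :
    (η (.pt u S)).2 (Sum.inr g) = ⊥ := by
  have h := store_le_of_preserved hcomp hnu unlockEff_mono (fun _ _ _ _ h => unlockEff_ne_pt h) hη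
    (fun _ _ g => if p.Written g then ⊤ else ⊥) (fun _ _ _ _ _ _ _ _ _ => inf_le_right)
    (fun u S g x v hr he => if_pos ⟨u, S, x, v, hr, he⟩) u S g
  simpa [hg] using h

include hatomic hprot

-- The bound is vacuous while `mtx g` is held, in particular at writes. It becomes effective only at
-- `unlock (mtx g)`, which side-effects `[g]'` with the copy.
open scoped Classical in
theorem store_le_glob' {u : N} {S : Set M} {g : G} (hg : p.mtx g ∉ S) :
    (η (.pt u S)).2 (Sum.inr g) ≤ (η (.glob' g) : D) := by
  have h := store_le_of_preserved hcomp hnu unlockEff_mono (fun _ _ _ _ h => unlockEff_ne_pt h) hη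
    (fun _ S g => if p.mtx g ∈ S then (⊤ : D) else η (.glob' g)) ?_ ?_ u S g
  · simpa only [if_neg hg] using h
  · intro u S A v g hr he hen hA
    by_cases h2 : p.mtx g ∈ A.post S
    · rw [if_pos h2]; exact le_top
    rw [if_neg h2]
    by_cases h1 : p.mtx g ∈ S
    · refine inf_le_left.trans ?_
      obtain ⟨b, rfl⟩ : ∃ b, A = .unlock b := by
        cases A <;> simp_all [Action.post]
      have hs := ((isSolution_pSystem_iff.1 hη.1).2 u S _ v hr he hen).1
      exact ((unlockEff_bounded (S := S)).1 hs).1 g (hr.eq_of_unlock hatomic he h1)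
    · rw [if_neg h1]; exact inf_le_right
  · intro u S g x v hr he
    exact if_pos (hprot.2 _ _ _ _ _ hr he (hprot.1 g))

-- The bound becomes effective when the first mutex of `prot g \ {mtx g}` is released. If `g` is
-- written, that mutex is not dedicated to any global, so its release side-effects `[g]`; if not,
-- the copy is `⊥`.
open scoped Classical in
theorem store_le_glob {u : N} {S : Set M} {g : G} (hg : ¬ (prot g \ {p.mtx g} ⊆ S)) :
    (η (.pt u S)).2 (Sum.inr g) ≤ (η (.glob g) : D) := by
  have h := store_le_of_preserved hcomp hnu unlockEff_mono (fun _ _ _ _ h => unlockEff_ne_pt h) hη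
    (fun _ S g => if prot g \ {p.mtx g} ⊆ S then (⊤ : D) else η (.glob g)) ?_ ?_ u S g
  · simpa only [if_neg hg] using h
  · intro u S A v g hr he hen hA
    by_cases h2 : prot g \ {p.mtx g} ⊆ A.post S
    · rw [if_pos h2]; exact le_top
    rw [if_neg h2]
    by_cases h1 : prot g \ {p.mtx g} ⊆ S
    · refine inf_le_left.trans ?_
      by_cases hw : p.Written g
      swap
      · rw [store_eq_bot_of_not_written hcomp hnu hη hw]; exact bot_le
      obtain ⟨b, hb, hb'⟩ := Set.not_subset.1 h2
      obtain rfl : A = .unlock b := by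
        have := h1 hb
        cases A <;> simp_all [Action.post]
      have hs := ((isSolution_pSystem_iff.1 hη.1).2 u S _ v hr he hen).1
      exact ((unlockEff_bounded (S := S)).1 hs).2.2 g (hw.notMem_range hatomic hprot hb.1 hb.2) hb.1
    · rw [if_neg h1]; exact inf_le_right
  · intro u S g x v hr he
    exact if_pos (Set.sdiff_subset.trans (hprot.2 _ _ _ _ _ hr he))

/-- The least solution of `C₁` accounts for the additional side-effects of `C₁'`. -/
theorem IsLeastSolution.isSolution_C₁' : IsSolution (C₁' p prot comp nu) η := by
  have hsol := isSolution_pSystem_iff.1 hη.1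
  refine isSolution_pSystem_iff.2 ⟨hsol.1, fun u S A v hr he hen => ?_⟩
  have hs := hsol.2 u S A v hr he hen
  cases A with
  | unlock b =>
    refine ⟨unlockEff'_bounded.2 ⟨fun g hg => ?_, ((unlockEff_bounded (S := S)).1 hs.1).2.1,
      fun g _ => ?_⟩, hs.2⟩
    -- Unlocking keeps the store, so the side-effected value is below the copy at the successor,
    -- whose lockset `S \ {b}` satisfies the premise of the invariant.
    · exact (hs.2.2 (Sum.inr g)).trans (store_le_glob hatomic hprot hcomp hnu hη hg)
    · exact (hs.2.2 (Sum.inr g)).trans (store_le_glob' hatomic hprot hcomp hnu hη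
        (hr.mtx_notMem_of_unlock hatomic he g))
  | comp l => exact hs
  | create x u₁ => exact hs
  | lock a => exact hs
  | write g x => exact hs
  | read x g => exact hs

/-- Every value sent to `[g]` is also below `[g]'`: either `mtx g` is being released, or no
dedicated mutex is held after the unlock. Lowering `[g]` to the meet thus preserves the solution. -/
theorem IsLeastSolution.glob_le_glob' (g : G) : (η (.glob g) : D) ≤ η (.glob' g) := by
  let ζ : PAssign N X G M D
    | .pt u S => η (.pt u S)
    | .glob g => (η (.glob g) ⊓ η (.glob' g) : D)
    | .glob' g => η (.glob' g)
  suffices h : IsSolution (C₁ p prot comp nu) ζ from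
    (show (η (.glob g) : D) ≤ η (.glob g) ⊓ η (.glob' g) from hη.2 h (.glob g)).trans inf_le_right
  have hζ : ζ ≤ η := by
    rintro (⟨u, S⟩ | g | g)
    · exact (le_rfl : (η (.pt u S) : PState X G D) ≤ _)
    · exact (inf_le_left : (η (.glob g) ⊓ η (.glob' g) : D) ≤ _)
    · exact (le_rfl : (η (.glob' g) : D) ≤ _)
  have hsol := isSolution_pSystem_iff.1 hη.1
  refine isSolution_pSystem_iff.2 ⟨hsol.1, fun u S A v hr he hen => ?_⟩
  have hs := hsol.2 u S A v hr he hen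
  have hm := pRhs_mono (p := p) (prot := prot) hcomp hnu
    (unlockEff_mono (p := p) (prot := prot)) u S A v (A.post S) _ _ hζ
  refine ⟨?_, le_trans hm.2 hs.2⟩
  cases A with
  | unlock b =>
    have h1 := (unlockEff_bounded (S := S)).1 hs.1
    refine (unlockEff_bounded (S := S)).2 ⟨h1.1, fun g hb hg => le_inf (h1.2.1 g hb hg) (h1.1 g hb),
      fun g hb hg => le_inf (h1.2.2 g hb hg) ?_⟩
    exact (hs.2.2 (Sum.inr g)).trans (store_le_glob' hatomic hprot hcomp hnu hη
        (hr.mtx_notMem_of_unlock hatomic he g))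
  | create x u₁ =>
    intro e h
    obtain rfl : e = _ := h
    exact hs.1 _ rfl
  | comp l => exact fun e h => absurd h (Set.notMem_empty _)
  | lock a => exact fun e h => absurd h (Set.notMem_empty _)
  | write g x => exact fun e h => absurd h (Set.notMem_empty _)
  | read x g => exact fun e h => absurd h (Set.notMem_empty _)

end Least

theorem IsSolution.isSolution_C₁ {η : PAssign N X G M D}
    (hη : IsSolution (C₁' p prot comp nu) η) : IsSolution (C₁ p prot comp nu) η := by
  have hsol := isSolution_pSystem_iff.1 hη
  refine isSolution_pSystem_iff.2 ⟨hsol.1, fun u S A v hr he hen => ?_⟩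
  have hs := hsol.2 u S A v hr he hen
  cases A with
  | unlock b =>
    obtain ⟨h1, h2, h3⟩ := unlockEff'_bounded.1 hs.1
    refine ⟨(unlockEff_bounded (S := S)).2 ⟨fun g hg => h3 g (Or.inl ⟨g, hg.symm⟩), h2, fun g hb hg => h1 g ?_⟩,
      hs.2⟩
    -- The released `b` itself witnesses that `g` is no longer totally protected.
    exact fun h => (h ⟨hg, fun h' => hb ⟨g, h'.symm⟩⟩).2 rfl
  | comp l => exact hs
  | create x u₁ => exact hs
  | lock a => exact hs
  | write g x => exact hs
  | read x g => exact hs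

end ProtectionBased

/-! ### The induced solution of Write-Centered Reading -/

section Relating

variable {N X G M L D : Type u} [CompleteLattice D] {p : Program N X G M L} {prot : G → Set M}

theorem upMem_upLocks {B : Set (Set M)} {S : Set M} : UpMem S (upLocks B) ↔ ∃ T ∈ B, T ⊆ S :=
  Iff.rfl

theorem upLocks_le_iff {B : Set (Set M)} {A : UpLocks M} : upLocks B ≤ A ↔ ∀ S ∈ B, UpMem S A := by
  constructor
  · exact fun h S hS => h (subset_upperClosure hS)
  · rintro h S ⟨T, hT, hTS⟩
    exact (OrderDual.ofDual A).upper hTS (h T hT)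

theorem gammaState_snd_of_mem {X G M D : Type u} {prot : G → Set M} {q : PState X G D} {g : G} (h : g ∈ OrderDual.ofDual q.1) :
    (gammaState prot q).2.1 g = upLocks {B | ∃ a ∈ prot g, B = {a}} := if_pos h

theorem gammaState_snd_of_notMem {X G M D : Type u} {prot : G → Set M} {q : PState X G D} {g : G} (h : g ∉ OrderDual.ofDual q.1) :
    (gammaState prot q).2.1 g = upLocks {∅} := if_neg h

/-- The form in which `γ` is used: for `g ∈ P`, at least one mutex protecting `g` has been held
throughout. -/
theorem upMem_gammaState {X G M D : Type u} {prot : G → Set M} {q : PState X G D} {g : G} {S : Set M} :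
    UpMem S ((gammaState prot q).2.1 g) ↔
      (g ∈ OrderDual.ofDual q.1 → (S ∩ prot g).Nonempty) := by
  by_cases h : g ∈ OrderDual.ofDual q.1
  · rw [gammaState_snd_of_mem h, upMem_upLocks]
    constructor
    · rintro ⟨_, ⟨a, ha, rfl⟩, h'⟩ _
      exact ⟨a, h' rfl, ha⟩
    · intro h'
      obtain ⟨a, ha, ha'⟩ := h' h
      exact ⟨{a}, ⟨a, ha', rfl⟩, by simpa using ha⟩
  · rw [gammaState_snd_of_notMem h, upMem_upLocks]
    simp [h]

theorem gammaState_mono {q q' : PState X G D} (h : q ≤ q') :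
    gammaState prot q ≤ gammaState prot q' :=
  ⟨le_rfl, fun _ _ hS => upMem_gammaState.2 fun hg => upMem_gammaState.1 hS (h.1 hg), h.2⟩

variable {η : PAssign N X G M D}

theorem eta₃_glob_of_retained {g : G} {a : M} {S w : Set M} (h1 : a = p.mtx g ∨ a ∉ prot g)
    (h2 : prot g \ {p.mtx g} ⊆ S) (h3 : prot g ⊆ w) :
    (eta₃ p prot η (.glob g a S w) : D) = η (.glob' g) := if_pos ⟨h1, h2, h3⟩

theorem eta₃_glob_of_not_subset {g : G} {a : M} {S w : Set M} (h : ¬ prot g ⊆ w) :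
    (eta₃ p prot η (.glob g a S w) : D) = ⊥ :=
  (if_neg fun h' => h h'.2.2).trans (if_pos h)

theorem eta₃_glob_of_not_retained {g : G} {a : M} {S w : Set M} (h3 : prot g ⊆ w)
    (h : ¬ ((a = p.mtx g ∨ a ∉ prot g) ∧ prot g \ {p.mtx g} ⊆ S)) :
    (eta₃ p prot η (.glob g a S w) : D) = η (.glob g) :=
  (if_neg fun h' => h ⟨h'.1, h'.2.1⟩).trans (if_neg (not_not.2 h3))

theorem eta₃_le_of_describes_glob {g : G} {a : M} {S w : Set M}
    (h : Describes p prot (.glob g a S w) (.glob g : PUnk N G M)) :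
    (eta₃ p prot η (.glob g a S w) : D) ≤ η (.glob g) := by
  cases h with
  | own _ _ _ _ hw ha =>
    exact (eta₃_glob_of_not_retained hw fun h => h.1.elim ha.2 fun h' => h' ha.1).le
  | released _ _ _ _ hw ha hS => exact (eta₃_glob_of_not_retained hw fun h => hS h.2).le

theorem eta₃_le_of_describes_glob' {g : G} {a : M} {S w : Set M}
    (h : Describes p prot (.glob g a S w) (.glob' g : PUnk N G M)) :
    (eta₃ p prot η (.glob g a S w) : D) ≤ η (.glob' g) := by
  cases h with
  | retained _ _ _ _ hw ha hS => exact (eta₃_glob_of_retained ha hS hw).le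

/-- Values side-effected by `C₁'` when unlocking are described by `[g,a,S \ {a},w]`. -/
theorem le_of_unlock_of_describes {u : N} {S : Set M} {a : M}
    (h : ∀ e ∈ unlockEff' p prot S a (η (.pt u S)).2, e.2 ≤ η e.1) (g : G) (w : Set M) :
    (Describes p prot (.glob g a (S \ {a}) w) (.glob g : PUnk N G M) →
      (η (.pt u S)).2 (Sum.inr g) ≤ (η (.glob g) : D)) ∧
    (Describes p prot (.glob g a (S \ {a}) w) (.glob' g : PUnk N G M) →
      (η (.pt u S)).2 (Sum.inr g) ≤ (η (.glob' g) : D)) := by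
  obtain ⟨h1, -, h3⟩ := unlockEff'_bounded.1 h
  refine ⟨fun hd => h1 g ?_, fun hd => h3 g ?_⟩
  · cases hd with
    | own _ _ _ _ hw ha => exact fun hsub => (hsub ha).2 rfl
    | released _ _ _ _ hw ha hS => exact hS
  · cases hd with
    | retained _ _ _ _ hw ha hS => exact ha.imp_left fun h => ⟨g, h.symm⟩

/-- Unlocks match because the description relation covers every triple with `w = prot g`. Reads are
split by the three branches of the protection-based read. -/
theorem isSolution_eta₃ {comp : L → (X → D) → (X → D)} {nu₁ : N → PState X G D → N → D}
    {nu₃ : N → WState X G M D → N → D}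
    (hatomic : p.Atomic) (hprot : p.WriteProtects prot)
    (hnu : ∀ u q u₁, nu₃ u (gammaState prot q) u₁ ≤ nu₁ u q u₁)
    (hη : IsSolution (C₁' p prot comp nu₁) η)
    (hle : ∀ g, (η (.glob g) : D) ≤ η (.glob' g)) :
    IsSolution (C₃ p comp nu₃) (eta₃ p prot η) := by
  have hsol := isSolution_pSystem_iff.1 hη
  rintro c (rfl | ⟨u, S, A, v, hr, he, hen, rfl⟩)
  · refine ⟨fun e he => absurd he (Set.notMem_empty e), ?_⟩
    refine WState.le_iff.2 ⟨fun g => ?_, fun g => ?_, hsol.1.2⟩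
    · exact upLocks_le_iff.2 fun S hS => absurd hS (Set.notMem_empty S)
    · refine upLocks_le_iff.2 fun S hS => upMem_gammaState.2 fun hg => ?_
      exact absurd (hsol.1.1 hg) (Set.notMem_empty g)
  have hs := hsol.2 u S A v hr he hen
  cases A with
  | comp l => exact ⟨fun e he => absurd he (Set.notMem_empty e), gammaState_mono hs.2⟩
  | lock l => exact ⟨fun e he => absurd he (Set.notMem_empty e), gammaState_mono hs.2⟩
  | create x u₁ =>
    have hi := hnu u (η (.pt u S)) u₁
    constructor
    · intro e h
      obtain rfl : e = _ := h
      have h1 : ((OrderDual.toDual ∅, childStore p.self (η (.pt u S)).2 (nu₁ u (η (.pt u S)) u₁)) :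
        PState X G D) ≤ η (.pt u₁ ∅) := hs.1 _ rfl
      refine WState.le_iff.2 ⟨fun g => ?_, fun g => ?_, ?_⟩
      · exact upLocks_le_iff.2 fun S hS => absurd hS (Set.notMem_empty S)
      · refine upLocks_le_iff.2 fun S hS => upMem_gammaState.2 fun hg => ?_
        exact absurd (h1.1 hg) (Set.notMem_empty g)
      · exact (childStore_mono le_rfl hi).trans h1.2
    · refine le_trans ?_ (gammaState_mono hs.2)
      exact ⟨le_rfl, le_rfl, override_le_override le_rfl hi⟩
  | unlock a =>
    constructor
    · rintro e ⟨g, w, hw, rfl⟩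
      have hd := le_of_unlock_of_describes (η := η) hs.1 g w
      -- `W g` is generated by `prot g` alone, which is therefore its unique minimal element.
      obtain rfl : w = prot g := by
        obtain ⟨T, rfl, hT⟩ := upMem_upLocks.1 hw.1
        exact (hw.2 (upMem_upLocks.2 ⟨prot g, rfl, subset_rfl⟩) hT).antisymm hT
      by_cases h1 : a = p.mtx g ∨ a ∉ prot g
      · by_cases h2 : prot g \ {p.mtx g} ⊆ S \ {a}
        · exact (hd.2 (.retained _ _ _ _ subset_rfl h1 h2)).trans
            (eta₃_glob_of_retained h1 h2 subset_rfl).ge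
        · exact (hd.1 (.released _ _ _ _ subset_rfl h1 h2)).trans
            (eta₃_glob_of_not_retained subset_rfl fun h => h2 h.2).ge
      · push Not at h1
        exact (hd.1 (.own _ _ _ _ subset_rfl ⟨h1.2, h1.1⟩)).trans
            (eta₃_glob_of_not_retained subset_rfl fun h => h.1.elim h1.1 fun h' => h' h1.2).ge
    · refine WState.le_iff.2 ⟨fun _ => le_rfl, fun g => sup_le ?_ ?_, hs.2.2⟩
      · exact fun T hT => upMem_gammaState.2 fun hg => upMem_gammaState.1 hT (hs.2.1 hg).1
      · refine upLocks_le_iff.2 ?_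
        rintro _ rfl
        exact upMem_gammaState.2 fun hg => (hs.2.1 hg).2
  | write g x =>
    have hS := hprot.2 _ _ _ _ _ hr he
    refine ⟨fun e he => absurd he (Set.notMem_empty e), ?_⟩
    refine WState.le_iff.2 ⟨fun h => ?_, fun h => ?_, hs.2.2⟩
    · by_cases hh : h = g
      · subst hh
        refine (le_of_eq (override_same _ _ _)).trans (upLocks_le_iff.2 ?_)
        rintro _ rfl
        exact upMem_upLocks.2 ⟨prot h, rfl, hS⟩
      · exact (le_of_eq (override_of_ne hh)).trans le_rfl
    · by_cases hh : h = g
      · subst hh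
        refine (le_of_eq (override_same _ _ _)).trans (upLocks_le_iff.2 ?_)
        rintro _ rfl
        exact upMem_gammaState.2 fun _ => ⟨p.mtx h, hS (hprot.1 h), hprot.1 h⟩
      · refine (le_of_eq (override_of_ne hh)).trans fun T hT => ?_
        exact upMem_gammaState.2 fun hg => upMem_gammaState.1 hT ((hs.2.1 hg).resolve_right hh)
  | read x g =>
    have hm : p.mtx g ∈ S := hr.mtx_mem_of_accesses hatomic he (Or.inr ⟨x, rfl⟩)
    refine ⟨fun e he => absurd he (Set.notMem_empty e), ?_⟩
    refine le_trans ?_ (gammaState_mono hs.2)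
    refine WState.le_iff.2 ⟨fun _ => le_rfl, fun _ => le_rfl, override_le_override le_rfl ?_⟩
    by_cases hP : g ∈ OrderDual.ofDual (η (.pt u S)).1
    · rw [if_pos hP]
      refine sup_le le_rfl (sSup_le ?_)
      rintro _ ⟨a, S', w, ha, hS', ⟨T, hT, hTw⟩, -, rfl⟩
      obtain ⟨b, hbT, hb⟩ := upMem_gammaState.1 hT hP
      -- For `g ∈ P`, the set `T` meets `prot g` but not `w`. So all admitted unknowns have the
      -- value `⊥`, and the local copy suffices.
      have hw : ¬ prot g ⊆ w := fun h => (hTw ▸ ⟨hbT, h hb⟩ : b ∈ (∅ : Set M))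
      exact (eta₃_glob_of_not_subset hw).le.trans bot_le
    · rw [if_neg hP]
      by_cases h2 : S ∩ prot g = {p.mtx g}
      · rw [if_pos h2]
        refine sup_le le_sup_left (sSup_le ?_)
        rintro _ ⟨a, S', w, -, -, -, -, rfl⟩
        refine le_trans ?_ le_sup_right
        by_cases hw : prot g ⊆ w
        · by_cases h3 : (a = p.mtx g ∨ a ∉ prot g) ∧ prot g \ {p.mtx g} ⊆ S'
          · exact (eta₃_glob_of_retained h3.1 h3.2 hw).le
          · exact (eta₃_glob_of_not_retained hw h3).le.trans (hle g)
        · exact (eta₃_glob_of_not_subset hw).le.trans bot_le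
      · rw [if_neg h2]
        refine sup_le le_sup_left (sSup_le ?_)
        rintro _ ⟨a, S', w, -, hS', -, -, rfl⟩
        refine le_trans ?_ le_sup_right
        by_cases hw : prot g ⊆ w
        -- A retained contribution would have `prot g \ {mtx g} ⊆ S'` with `S'` disjoint from `S`,
        -- forcing `S ∩ prot g = {mtx g}`.
        · refine (eta₃_glob_of_not_retained hw fun h3 => h2 ?_).le
          refine Set.Subset.antisymm (fun b hb => ?_) (Set.singleton_subset_iff.2 ⟨hm, hprot.1 g⟩)
          by_contra hne
          exact (hS' ▸ ⟨hb.1, h3.2 ⟨hb.2, hne⟩⟩ : b ∈ (∅ : Set M))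
        · exact (eta₃_glob_of_not_subset hw).le.trans bot_le

end Relating
/-! ### Global traces -/

namespace Trace

variable {N X G M L V : Type u} {p : Program N X G M L} {sem : Semantics N X G M L V}
  {t : Trace N X G M L V} {z : Node N X V}

theorem le_refl (n : Node N X V) : t.le n n := Relation.ReflTransGen.refl

theorem le_trans {k m n : Node N X V} (h : t.le k m) (h' : t.le m n) : t.le k n :=
  Relation.ReflTransGen.trans h h'

theorem le_of_edge {m n : Node N X V} {A : Action N X G M L} (h : (m, A, n) ∈ t.edges) :
    t.le m n := Relation.ReflTransGen.single (Or.inl ⟨A, h⟩)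

theorem le_of_created {m n : Node N X V} (h : t.created m n) : t.le m n :=
  Relation.ReflTransGen.single (Or.inr (Or.inl h))

theorem le_of_locked {m n : Node N X V} {a : M} (h : t.locked a m n) : t.le m n :=
  Relation.ReflTransGen.single (Or.inr (Or.inr ⟨a, h⟩))

/-- `(m, g = x, k)` is the last write to `g` of the thread of `n`, up to `n`. -/
def LastWriteAt (p : Program N X G M L) (t : Trace N X G M L V) (n : Node N X V) (g : G)
    (m : Node N X V) (x : X) (k : Node N X V) : Prop :=
  (m, Action.write g x, k) ∈ t.edges ∧ k.st p.self = n.st p.self ∧ k.idx ≤ n.idx ∧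
  ∀ l y l', (l, Action.write g y, l') ∈ t.edges → l'.st p.self = n.st p.self → l'.idx ≤ n.idx →
    l'.idx ≤ k.idx

/-- `q` is the node where the thread of `n` releases the mutex `a` for the first time after `n`. -/
def Releases (p : Program N X G M L) (t : Trace N X G M L V) (a : M) (n q : Node N X V) : Prop :=
  (∃ k, (k, Action.unlock a, q) ∈ t.edges) ∧ q.st p.self = n.st p.self ∧ n.idx < q.idx ∧
  ∀ k' q', (k', Action.unlock a, q') ∈ t.edges → q'.st p.self = n.st p.self → n.idx < q'.idx →
    q.idx ≤ q'.idx

namespace IsGlobal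

variable (h : t.IsGlobal p sem z)
include h

theorem finite_nodes : t.nodes.Finite := by
  obtain ⟨I, r, hI, hr, hn, he⟩ := h.raw
  rw [hn]
  refine hI.biUnion fun i _ => ((Set.finite_Iic (r i).len).image (r i).node).subset ?_
  rintro n ⟨j, hj, rfl⟩
  exact ⟨j, hj, rfl⟩

/-- Each thread has one raw trace, so thread id and index determine a node. -/
theorem node_ext {m n : Node N X V} (hm : m ∈ t.nodes) (hn : n ∈ t.nodes)
    (hs : m.st p.self = n.st p.self) (hi : m.idx = n.idx) : m = n := by
  obtain ⟨I, r, -, hr, hnodes, -⟩ := h.raw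
  simp only [hnodes, Set.mem_iUnion] at hm hn
  obtain ⟨i, hiI, j, hj, rfl⟩ := hm
  obtain ⟨i', hiI', j', hj', rfl⟩ := hn
  obtain rfl : i = i' := by
    rw [← (hr i hiI).1 j hj, ← (hr i' hiI').1 j' hj']
    exact hs
  obtain rfl : j = j' := hi
  rfl

theorem edge_spec {m n : Node N X V} {A : Action N X G M L} (he : (m, A, n) ∈ t.edges) :
    m ∈ t.nodes ∧ n ∈ t.nodes ∧ n.idx = m.idx + 1 ∧ m.st p.self = n.st p.self ∧
      (m.pt, A, n.pt) ∈ p.edges ∧ LocalStep sem m.st A n.st := by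
  obtain ⟨I, r, -, hr, hnodes, hedges⟩ := h.raw
  simp only [hedges, Set.mem_iUnion] at he
  obtain ⟨i, hi, j, hj, hje⟩ := he
  obtain ⟨rfl, rfl, rfl⟩ : m = _ ∧ A = _ ∧ n = _ := by simpa using hje
  have hrr := hr i hi
  refine ⟨?_, ?_, rfl, (hrr.1 j hj.le).trans (hrr.1 (j + 1) hj).symm, (hrr.2 j hj).1,
    (hrr.2 j hj).2⟩
  · rw [hnodes]; exact Set.mem_biUnion hi ⟨j, hj.le, rfl⟩
  · rw [hnodes]; exact Set.mem_biUnion hi ⟨j + 1, hj, rfl⟩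

theorem edge_action {m n n' : Node N X V} {A A' : Action N X G M L} (he : (m, A, n) ∈ t.edges)
    (he' : (m, A', n') ∈ t.edges) : A = A' := by
  obtain ⟨I, r, -, hr, hnodes, hedges⟩ := h.raw
  simp only [hedges, Set.mem_iUnion] at he he'
  obtain ⟨i, hi, j, hj, hje⟩ := he
  obtain ⟨i', hi', j', hj', hje'⟩ := he'
  obtain ⟨rfl, rfl, rfl⟩ : m = _ ∧ A = _ ∧ n = _ := by simpa using hje
  obtain ⟨hm, rfl, rfl⟩ : (r i).node j = _ ∧ A' = _ ∧ n' = _ := by simpa using hje'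
  obtain rfl : j = j' := congrArg Node.idx hm
  obtain rfl : i = i' := by
    rw [← (hr i hi).1 j hj.le, ← (hr i' hi').1 j hj'.le]
    exact congrArg (fun n => n.st p.self) hm
  rfl

theorem edge_unique {m m' n : Node N X V} {A A' : Action N X G M L} (he : (m, A, n) ∈ t.edges)
    (he' : (m', A', n) ∈ t.edges) : m = m' ∧ A = A' := by
  obtain ⟨h1, -, h2, h3, -⟩ := h.edge_spec he
  obtain ⟨h1', -, h2', h3', -⟩ := h.edge_spec he'
  obtain rfl : m = m' := h.node_ext h1 h1' (h3.trans h3'.symm) (by omega)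
  exact ⟨rfl, h.edge_action he he'⟩

theorem exists_edge_to {n : Node N X V} (hn : n ∈ t.nodes) (h0 : n.idx ≠ 0) :
    ∃ m A, (m, A, n) ∈ t.edges := by
  obtain ⟨I, r, -, hr, hnodes, hedges⟩ := h.raw
  simp only [hnodes, Set.mem_iUnion] at hn
  obtain ⟨i, hi, j, hj, rfl⟩ := hn
  obtain ⟨j, rfl⟩ := Nat.exists_eq_succ_of_ne_zero (show j ≠ 0 from h0)
  refine ⟨(r i).node j, (r i).act j, ?_⟩
  rw [hedges]
  exact Set.mem_biUnion hi ⟨j, hj, rfl⟩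

theorem le_of_idx_le {m n : Node N X V} (hm : m ∈ t.nodes) (hn : n ∈ t.nodes)
    (hs : m.st p.self = n.st p.self) (hi : m.idx ≤ n.idx) : t.le m n := by
  obtain ⟨d, hd⟩ := Nat.exists_eq_add_of_le hi
  induction d generalizing n with
  | zero => rw [h.node_ext hm hn hs hd.symm]; exact le_refl n
  | succ d ih =>
    obtain ⟨k, A, he⟩ := h.exists_edge_to hn (by omega)
    obtain ⟨hk, -, h2, h3, -⟩ := h.edge_spec he
    exact (ih hk (hs.trans h3.symm) (by omega) (by omega)).trans (le_of_edge he)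

theorem idx_le_of_le {m n : Node N X V} (hm : m ∈ t.nodes) (hn : n ∈ t.nodes)
    (hs : m.st p.self = n.st p.self) (hle : t.le m n) : m.idx ≤ n.idx := by
  by_contra hlt
  have := h.antisymm _ _ hle (h.le_of_idx_le hn hm hs.symm (by omega))
  subst this
  exact hlt le_rfl

theorem exists_edge_from {m n : Node N X V} (hm : m ∈ t.nodes) (hn : n ∈ t.nodes)
    (hs : m.st p.self = n.st p.self) (hi : m.idx < n.idx) :
    ∃ A k, (m, A, k) ∈ t.edges ∧ t.le k n := by
  obtain ⟨d, hd⟩ := Nat.exists_eq_add_of_lt hi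
  induction d generalizing n with
  | zero =>
    obtain ⟨k, A, he⟩ := h.exists_edge_to hn (by omega)
    obtain ⟨hk, -, h2, h3, -⟩ := h.edge_spec he
    obtain rfl : k = m := h.node_ext hk hm (h3.trans hs.symm) (by omega)
    exact ⟨A, n, he, le_refl n⟩
  | succ d ih =>
    obtain ⟨k, A, he⟩ := h.exists_edge_to hn (by omega)
    obtain ⟨hk, -, h2, h3, -⟩ := h.edge_spec he
    obtain ⟨B, l, hl, hle⟩ := ih hk (hs.trans h3.symm) (by omega) (by omega)
    exact ⟨B, l, hl, hle.trans (le_of_edge he)⟩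

theorem mem_left_of_le {m n : Node N X V} (hle : t.le m n) (hn : n ∈ t.nodes) : m ∈ t.nodes := by
  induction hle using Relation.ReflTransGen.head_induction_on with
  | refl => exact hn
  | head hstep _ _ =>
    rcases hstep with ⟨A, he⟩ | hc | ⟨a, hl⟩
    · exact (h.edge_spec he).1
    · exact (h.created_dom _ _ hc).1
    · rcases (h.locked_dom _ _ _ hl).1 with rfl | ⟨k, hk⟩
      · exact h.init.1
      · exact (h.edge_spec hk).2.1

/-- Induction along the causality order. -/
theorem node_induction {Q : Node N X V → Prop}
    (ih : ∀ n ∈ t.nodes, (∀ k ∈ t.nodes, t.le k n → k ≠ n → Q k) → Q n) :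
    ∀ n ∈ t.nodes, Q n := by
  -- The number of nodes below decreases strictly, by finiteness and antisymmetry.
  suffices H : ∀ (c : ℕ), ∀ n ∈ t.nodes, {k ∈ t.nodes | t.le k n}.ncard < c → Q n from
    fun n hn => H _ n hn (Nat.lt_succ_self _)
  intro c
  induction c with
  | zero => exact fun n _ hc => absurd hc (Nat.not_lt_zero _)
  | succ c hc =>
    intro n hn hlt
    refine ih n hn fun k hk hle hne => hc k hk (lt_of_lt_of_le ?_ (Nat.lt_succ_iff.1 hlt))
    refine Set.ncard_lt_ncard ⟨fun l hl => ⟨hl.1, hl.2.trans hle⟩, fun hsub => ?_⟩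
      (h.finite_nodes.subset (Set.sep_subset _ _))
    exact hne (h.antisymm _ _ hle (hsub ⟨hn, le_refl n⟩).2)

theorem lockset_of_idx_zero {n : Node N X V} (h0 : n.idx = 0) : t.lockset p n = ∅ := by
  refine Set.eq_empty_of_forall_notMem ?_
  rintro a ⟨m, m', he, -, hi, -⟩
  have := (h.edge_spec he).2.2.1
  omega

theorem lockset_step {m n : Node N X V} {A : Action N X G M L} (he : (m, A, n) ∈ t.edges) :
    t.lockset p n = A.post (t.lockset p m) := by
  obtain ⟨hm, hn, hi, hs, -⟩ := h.edge_spec he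
  have heq : ∀ k k' B, (k, B, k') ∈ t.edges → k'.st p.self = n.st p.self → k'.idx = n.idx →
      B = A := by
    intro k k' B hk hks hki
    obtain rfl := h.node_ext (h.edge_spec hk).2.1 hn hks hki
    exact (h.edge_unique hk he).2
  ext a
  constructor
  · rintro ⟨k, k', hk, hks, hki, hno⟩
    have hne : A ≠ .unlock a := by
      rintro rfl
      refine hno _ _ he rfl (lt_of_le_of_ne hki fun hki' => ?_) le_rfl
      cases heq _ _ _ hk hks hki'
    by_cases hki' : k'.idx = n.idx
    · obtain rfl := heq _ _ _ hk hks hki'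
      exact Or.inr rfl
    · have ha : a ∈ t.lockset p m := ⟨k, k', hk, hks.trans hs.symm, by omega,
        fun l l' hl hls hli hle => hno l l' hl (hls.trans hs) hli (by omega)⟩
      cases A with
      | unlock b => exact ⟨ha, fun hb => hne (by rw [Set.mem_singleton_iff.1 hb])⟩
      | lock b => exact Or.inl ha
      | _ => exact ha
  · intro ha
    have hold : a ∈ t.lockset p m → A ≠ .unlock a → a ∈ t.lockset p n := by
      rintro ⟨k, k', hk, hks, hki, hno⟩ hne
      refine ⟨k, k', hk, hks.trans hs, by omega, fun l l' hl hls hli hle => ?_⟩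
      by_cases hl' : l'.idx = n.idx
      · exact hne (heq _ _ _ hl hls hl').symm
      · exact hno l l' hl (hls.trans hs.symm) hli (by omega)
    cases A with
    | unlock b => exact hold ha.1 fun hb => ha.2 (by injection hb with hb; rw [hb]; rfl)
    | lock b =>
      rcases ha with ha | rfl
      · exact hold ha (by simp)
      · exact ⟨m, n, he, rfl, le_rfl, fun _ _ _ _ h1 h2 => absurd h2 (by omega)⟩
    | _ => exact hold ha (by simp)

/-- Antisymmetry of a reflexive closure does not exclude loops. A self-created node would have no
other incoming edge, so it could not be reached from `z`. -/
theorem created_ne {m s : Node N X V} (hc : t.created m s) : m ≠ s := by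
  rintro rfl
  obtain ⟨hm, -, h0, hz, -⟩ := h.created_dom m m hc
  suffices H : ∀ n, t.le z n → n ≠ m from H m (h.least m hm) rfl
  intro n hn
  induction hn with
  | refl => exact hz.symm
  | @tail b c _ hstep ih =>
    rintro rfl
    rcases hstep with ⟨A, he⟩ | hc' | ⟨a, hl⟩
    · have := (h.edge_spec he).2.2.1
      omega
    · exact ih ((h.created_unique c hm h0 hz).unique hc' hc)
    · obtain ⟨k, hk⟩ := (h.locked_dom _ _ _ hl).2
      have := (h.edge_spec hk).2.2.1
      omega

theorem reach {n : Node N X V} (hn : n ∈ t.nodes) : p.Reach n.pt (t.lockset p n) := by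
  refine h.node_induction (Q := fun n => p.Reach n.pt (t.lockset p n)) ?_ n hn
  intro n hn ih
  by_cases h0 : n.idx = 0
  · rw [h.lockset_of_idx_zero h0]
    by_cases hz : n = z
    · rw [hz, h.init.2.2.1]; exact .start
    · obtain ⟨m, hm, -⟩ := h.created_unique n hn h0 hz
      obtain ⟨hmn, -, -, -, ⟨x, v, he⟩, -⟩ := h.created_dom m n hm
      refine .spawn (ih m hmn (le_of_created hm) ?_) he
      rintro rfl
      exact h.created_ne hm rfl
  · obtain ⟨m, A, he⟩ := h.exists_edge_to hn h0
    obtain ⟨hm, -, hi, hs, hpe, -⟩ := h.edge_spec he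
    rw [h.lockset_step he]
    refine .step (ih m hm (le_of_edge he) ?_) hpe (h.enabled _ _ _ he)
    rintro rfl
    omega

theorem releases_unique {a : M} {n q q' : Node N X V} (hq : Releases p t a n q)
    (hq' : Releases p t a n q') : q = q' := by
  obtain ⟨⟨k, hk⟩, hs, hi, hmin⟩ := hq
  obtain ⟨⟨k', hk'⟩, hs', hi', hmin'⟩ := hq'
  exact h.node_ext (h.edge_spec hk).2.1 (h.edge_spec hk').2.1 (hs.trans hs'.symm)
    (le_antisymm (hmin _ _ hk' hs' hi') (hmin' _ _ hk hs hi))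

/-- The acquisitions of a mutex form a chain, each one being preceded by the release which ends
the previous one. -/
theorem exists_first_lock {a : M} {n : Node N X V} (hn : ∃ k, (k, Action.lock a, n) ∈ t.edges) :
    ∃ f, t.locked a z f ∧
      Relation.ReflTransGen (fun m m' => ∃ q, Releases p t a m q ∧ t.locked a q m') f n := by
  obtain ⟨k, hk⟩ := hn
  refine h.node_induction (Q := fun n => ∀ k, (k, Action.lock a, n) ∈ t.edges → ∃ f, t.locked a z f ∧
      Relation.ReflTransGen (fun m m' => ∃ q, Releases p t a m q ∧ t.locked a q m') f n)
      ?_ n (h.edge_spec hk).2.1 k hk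
  intro n hn ih k hk
  obtain ⟨q, hq, -⟩ := h.locked_unique a k n hk
  rcases (h.locked_dom a q n hq).1 with rfl | ⟨l, hl⟩
  · exact ⟨n, hq, .refl⟩
  -- The unlock preceding `n` in the locking order was enabled, so it ends an earlier acquisition
  -- `m'`, to which the induction hypothesis applies.
  obtain ⟨m, m', hm, hms, hmi, hno⟩ : a ∈ t.lockset p l := h.enabled _ _ _ hl
  obtain ⟨hln, hqn, hqi, hqs, -⟩ := h.edge_spec hl
  have hm'n := (h.edge_spec hm).2.1
  have hle : t.le m' q :=
    (h.le_of_idx_le hm'n hln hms hmi).trans (le_of_edge hl)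
  have hqle : t.le q n := le_of_locked hq
  obtain ⟨f, hf, hfm⟩ := ih m' hm'n (hle.trans hqle) (by
    rintro rfl
    have := h.antisymm _ _ hle hqle
    subst this
    omega) m hm
  refine ⟨f, hf, hfm.tail ⟨q, ⟨⟨l, hl⟩, hqs.symm.trans hms.symm, by omega, ?_⟩, hq⟩⟩
  intro k' q' hq' hs' hi'
  by_contra hlt
  exact hno k' q' hq' (hs'.trans hms) hi' (by omega)

theorem le_of_releases {a : M} {n q : Node N X V} (hn : n ∈ t.nodes)
    (hq : Releases p t a n q) : t.le n q := by
  obtain ⟨⟨k, hk⟩, hs, hi, -⟩ := hq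
  exact h.le_of_idx_le hn (h.edge_spec hk).2.1 hs.symm hi.le

/-- Mutual exclusion: if two threads hold the mutex `a` at `c` and `d`, respectively, then one of
them releases it before the node of the other. -/
theorem exists_unlock_of_mem_lockset {a : M} {c d : Node N X V} (hc : c ∈ t.nodes)
    (hd : d ∈ t.nodes) (hcd : c.st p.self ≠ d.st p.self) (hac : a ∈ t.lockset p c)
    (had : a ∈ t.lockset p d) :
    (∃ k q, (k, Action.unlock a, q) ∈ t.edges ∧ q.st p.self = c.st p.self ∧ c.idx < q.idx ∧
      t.le q d) ∨
    (∃ k q, (k, Action.unlock a, q) ∈ t.edges ∧ q.st p.self = d.st p.self ∧ d.idx < q.idx ∧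
      t.le q c) := by
  obtain ⟨kc, nc, hkc, hsc, hic, hnoc⟩ := hac
  obtain ⟨kd, nd, hkd, hsd, hid, hnod⟩ := had
  obtain ⟨f, hf, hfc⟩ := h.exists_first_lock ⟨kc, hkc⟩
  obtain ⟨f', hf', hfd⟩ := h.exists_first_lock ⟨kd, hkd⟩
  -- The start node has one successor per mutex, so both chains of acquisitions begin at the same
  -- `f`.
  obtain rfl := h.locked_inj _ _ _ _ hf hf'
  -- If the acquisition `n` held at `c` precedes `n'`, it is released before the next acquisition in
  -- the chain, hence before `d`; and only after `c`, where the mutex is still held.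
  have key : ∀ c d k n n', c ∈ t.nodes → d ∈ t.nodes → n'.st p.self = d.st p.self →
      n'.idx ≤ d.idx → (k, Action.lock a, n) ∈ t.edges → n.st p.self = c.st p.self →
      n.idx ≤ c.idx → n' ∈ t.nodes → (∀ k k', (k, Action.unlock a, k') ∈ t.edges →
        k'.st p.self = c.st p.self → n.idx < k'.idx → ¬ k'.idx ≤ c.idx) → n ≠ n' →
      Relation.ReflTransGen (fun m m' => ∃ q, Releases p t a m q ∧ t.locked a q m') n n' →
      ∃ k q, (k, Action.unlock a, q) ∈ t.edges ∧ q.st p.self = c.st p.self ∧ c.idx < q.idx ∧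
        t.le q d := by
    intro c d k n n' hc hd hs' hi' hk hs hi hn' hno hne hr
    rcases Relation.ReflTransGen.cases_head hr with heq | ⟨m, ⟨q, hq, hqm⟩, hmn⟩
    · exact absurd heq hne
    have hle : t.le m n' := by
      have hm : m ∈ t.nodes := by
        obtain ⟨k, hk⟩ := (h.locked_dom _ _ _ hqm).2
        exact (h.edge_spec hk).2.1
      clear hqm
      induction hmn using Relation.ReflTransGen.head_induction_on with
      | refl => exact le_refl _
      | @head x y hstep hxy ih =>
        obtain ⟨q', hq', hqy⟩ := hstep
        obtain ⟨k, hk⟩ := (h.locked_dom _ _ _ hqy).2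
        exact (h.le_of_releases hm hq').trans ((le_of_locked hqy).trans
          (ih (h.edge_spec hk).2.1))
    obtain ⟨⟨l, hl⟩, hqs, hqi, -⟩ := hq
    exact ⟨l, q, hl, hqs.trans hs, not_le.1 (hno l q hl (hqs.trans hs) hqi),
      ((le_of_locked hqm).trans hle).trans (h.le_of_idx_le hn' hd hs' hi')⟩
  have hne : nc ≠ nd := by
    rintro rfl
    exact hcd (hsc.symm.trans hsd)
  -- First releases and lock successors are unique, so two chains from `f` are comparable.
  have hru : Relator.RightUnique (fun m m' => ∃ q, Releases p t a m q ∧ t.locked a q m') := by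
    rintro m n n' ⟨q, hq, hqn⟩ ⟨q', hq', hqn'⟩
    obtain rfl := h.releases_unique hq hq'
    exact h.locked_inj _ _ _ _ hqn hqn'
  rcases Relation.ReflTransGen.total_of_right_unique hru hfc hfd with hr | hr
  · exact Or.inl (key c d kc nc nd hc hd hsd hid hkc hsc hic (h.edge_spec hkd).2.1 hnoc hne hr)
  · exact Or.inr (key d c kd nd nc hd hc hsc hic hkd hsd hid (h.edge_spec hkc).2.1 hnod hne.symm hr)

end IsGlobal
end Trace
/-! ### Sub-traces -/

namespace Trace

variable {N X G M L V : Type u} {p : Program N X G M L} {sem : Semantics N X G M L V}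
  {t : Trace N X G M L V} {z : Node N X V}

theorem le_of_down_le {n a b : Node N X V} (hab : (t.down n).le a b) : t.le a b := by
  refine Relation.ReflTransGen.mono ?_ _ _ hab
  rintro a b (⟨A, he⟩ | hc | ⟨c, hl⟩)
  · exact Or.inl ⟨A, he.1⟩
  · exact Or.inr (Or.inl hc.1)
  · exact Or.inr (Or.inr ⟨c, hl.1⟩)

theorem down_le_of_le {n a b : Node N X V} (hab : t.le a b) (hb : t.le b n) :
    (t.down n).le a b := by
  induction hab using Relation.ReflTransGen.head_induction_on with
  | refl => exact le_refl _
  | @head a c hstep hcb ih =>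
    have hc : t.le c n := le_trans hcb hb
    have ha : t.le a n := Relation.ReflTransGen.head hstep hc
    refine Relation.ReflTransGen.head ?_ ih
    rcases hstep with ⟨A, he⟩ | hcr | ⟨d, hl⟩
    · exact Or.inl ⟨A, he, ha, hc⟩
    · exact Or.inr (Or.inl ⟨hcr, ha, hc⟩)
    · exact Or.inr (Or.inr ⟨d, hl, ha, hc⟩)

theorem down_le_iff {n a b : Node N X V} (hb : t.le b n) : (t.down n).le a b ↔ t.le a b :=
  ⟨le_of_down_le, fun h => down_le_of_le h hb⟩

/-- Needed because new thread ids depend on the creator's local trace, which must be the same in `t`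
and in the sub-trace. -/
theorem down_down {m n : Node N X V} (hmn : t.le m n) : (t.down n).down m = t.down m := by
  have hiff : ∀ a, (t.down n).le a m ↔ t.le a m := fun a => down_le_iff hmn
  have htr : ∀ {a}, t.le a m → t.le a n := fun ha => le_trans ha hmn
  simp only [down, Trace.mk.injEq]
  refine ⟨?_, ?_, ?_, ?_⟩
  · ext k
    exact ⟨fun hk => ⟨hk.1.1, (hiff k).1 hk.2⟩, fun hk => ⟨⟨hk.1, htr hk.2⟩, (hiff k).2 hk.2⟩⟩
  · ext e
    exact ⟨fun he => ⟨he.1.1, (hiff _).1 he.2.1, (hiff _).1 he.2.2⟩,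
      fun he => ⟨⟨he.1, htr he.2.1, htr he.2.2⟩, (hiff _).2 he.2.1, (hiff _).2 he.2.2⟩⟩
  · ext k k'
    exact ⟨fun he => ⟨he.1.1, (hiff _).1 he.2.1, (hiff _).1 he.2.2⟩,
      fun he => ⟨⟨he.1, htr he.2.1, htr he.2.2⟩, (hiff _).2 he.2.1, (hiff _).2 he.2.2⟩⟩
  · ext a k k'
    exact ⟨fun he => ⟨he.1.1, (hiff _).1 he.2.1, (hiff _).1 he.2.2⟩,
      fun he => ⟨⟨he.1, htr he.2.1, htr he.2.2⟩, (hiff _).2 he.2.1, (hiff _).2 he.2.2⟩⟩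

theorem isSink_down {n : Node N X V} (hn : n ∈ t.nodes) : (t.down n).IsSink n :=
  ⟨⟨hn, le_refl n⟩, fun _ hk => down_le_of_le hk.2 (le_refl n)⟩

theorem mem_down_edges_iff {n m k : Node N X V} {A : Action N X G M L} :
    (m, A, k) ∈ (t.down n).edges ↔ (m, A, k) ∈ t.edges ∧ t.le k n :=
  ⟨fun he => ⟨he.1, he.2.2⟩, fun he => ⟨he.1, (le_of_edge he.1).trans he.2, he.2⟩⟩

theorem lastWriteAt_of_write {m s : Node N X V} {g : G} {x : X}
    (he : (m, Action.write g x, s) ∈ t.edges) : LastWriteAt p t s g m x s :=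
  ⟨he, rfl, le_rfl, fun _ _ _ _ _ hi => hi⟩

namespace IsGlobal

variable (h : t.IsGlobal p sem z)
include h

theorem down_eq_self {s : Node N X V} (hs : t.IsSink s) : t.down s = t := by
  cases t with
  | mk nodes edges created locked =>
    simp only [down, Trace.mk.injEq]
    refine ⟨?_, ?_, ?_, ?_⟩
    · ext k
      exact ⟨fun hk => hk.1, fun hk => ⟨hk, hs.2 k hk⟩⟩
    · ext e
      exact ⟨fun he => he.1, fun he => ⟨he, hs.2 _ (h.edge_spec he).1, hs.2 _ (h.edge_spec he).2.1⟩⟩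
    · ext k k'
      refine ⟨fun he => he.1, fun he => ?_⟩
      have hd := h.created_dom _ _ he
      exact ⟨he, hs.2 _ hd.1, hs.2 _ hd.2.1⟩
    · ext a k k'
      refine ⟨fun he => he.1, fun he => ?_⟩
      have hk' : k' ∈ nodes := by
        obtain ⟨l, hl⟩ := (h.locked_dom _ _ _ he).2
        exact (h.edge_spec hl).2.1
      exact ⟨he, hs.2 _ (h.mem_left_of_le (le_of_locked he) hk'), hs.2 _ hk'⟩

/-- A lockset depends only on earlier steps of the same thread, all of which survive the
restriction. -/
theorem down_lockset {n k : Node N X V} (hk : k ∈ t.nodes) (hkn : t.le k n) :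
    (t.down n).lockset p k = t.lockset p k := by
  have hle : ∀ m m' A, (m, A, m') ∈ t.edges → m'.st p.self = k.st p.self → m'.idx ≤ k.idx →
      (m, A, m') ∈ (t.down n).edges := fun m m' A he hs hi =>
    mem_down_edges_iff.2 ⟨he, (h.le_of_idx_le (h.edge_spec he).2.1 hk hs hi).trans hkn⟩
  ext a
  constructor
  · rintro ⟨m, m', he, hs, hi, hno⟩
    exact ⟨m, m', he.1, hs, hi, fun l l' hl hls hli hle' => hno l l' (hle _ _ _ hl hls hle') hls hli
      hle'⟩
  · rintro ⟨m, m', he, hs, hi, hno⟩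
    exact ⟨m, m', hle _ _ _ he hs hi, hs, hi, fun l l' hl => hno l l' hl.1⟩

theorem down_isLastWrite_iff {n : Node N X V} (hn : n ∈ t.nodes) {g : G} {m k : Node N X V}
    {x : X} : (t.down n).IsLastWrite p n g m x k ↔ LastWriteAt p t n g m x k := by
  have hle : ∀ {m m' A}, (m, A, m') ∈ t.edges → m'.st p.self = n.st p.self →
      (m'.idx ≤ n.idx ↔ t.le m' n) := fun he hs =>
    ⟨h.le_of_idx_le (h.edge_spec he).2.1 hn hs, h.idx_le_of_le (h.edge_spec he).2.1 hn hs⟩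
  constructor
  · rintro ⟨he, hs, hmax⟩
    exact ⟨he.1, hs, (hle he.1 hs).2 he.2.2, fun l y l' hl hls hli =>
      hmax l y l' (mem_down_edges_iff.2 ⟨hl, (hle hl hls).1 hli⟩) hls⟩
  · rintro ⟨he, hs, hi, hmax⟩
    exact ⟨mem_down_edges_iff.2 ⟨he, (hle he hs).1 hi⟩, hs, fun l y l' hl hls =>
      hmax l y l' hl.1 hls ((hle hl.1 hls).2 hl.2.2)⟩

theorem down_raw {n : Node N X V} :
    ∃ (I : Set V) (r : V → RawTrace N X G M L V), I.Finite ∧ (∀ i ∈ I, (r i).IsRaw p sem i) ∧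
      (t.down n).nodes = (⋃ i ∈ I, (r i).nodes) ∧ (t.down n).edges = ⋃ i ∈ I, (r i).edges := by
  classical
  obtain ⟨I, r, hI, hr, hnodes, hedges⟩ := h.raw
  have hmem : ∀ i ∈ I, ∀ j ≤ (r i).len, (r i).node j ∈ t.nodes := fun i hi j hj => by
    rw [hnodes]; exact Set.mem_biUnion hi ⟨j, hj, rfl⟩
  have hmono : ∀ i ∈ I, ∀ j k, j ≤ k → k ≤ (r i).len → t.le ((r i).node j) ((r i).node k) :=
    fun i hi j k hjk hk => h.le_of_idx_le (hmem i hi j (hjk.trans hk)) (hmem i hi k hk)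
      (((hr i hi).1 j (hjk.trans hk)).trans ((hr i hi).1 k hk).symm) hjk
  -- Each raw trace is cut at its last node below `n`. The default value `0` is harmless: threads
  -- whose first node is not below `n` are dropped from `I`.
  let len : V → ℕ := fun i => Nat.findGreatest (fun j => t.le ((r i).node j) n) (r i).len
  have hlen : ∀ i, len i ≤ (r i).len := fun i => Nat.findGreatest_le _
  have hle : ∀ i ∈ I, t.le ((r i).node 0) n → ∀ j ≤ len i, t.le ((r i).node j) n :=
    fun i hi h0 j hj => (hmono i hi j _ hj (hlen i)).trans
      (Nat.findGreatest_spec (P := fun j => t.le ((r i).node j) n) (Nat.zero_le _) h0)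
  refine ⟨{i ∈ I | t.le ((r i).node 0) n}, fun i => { r i with len := len i },
    hI.subset (Set.sep_subset _ _), ?_, ?_, ?_⟩
  · rintro i ⟨hi, h0⟩
    exact ⟨fun j hj => (hr i hi).1 j (hj.trans (hlen i)),
      fun j hj => (hr i hi).2 j (hj.trans_le (hlen i))⟩
  · ext k
    simp only [Set.mem_iUnion]
    constructor
    · rintro ⟨hk, hkn⟩
      simp only [hnodes, Set.mem_iUnion] at hk
      obtain ⟨i, hi, j, hj, rfl⟩ := hk
      exact ⟨i, ⟨hi, (hmono i hi 0 j (Nat.zero_le _) hj).trans hkn⟩, j,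
        Nat.le_findGreatest hj hkn, rfl⟩
    · rintro ⟨i, ⟨hi, h0⟩, j, hj, rfl⟩
      exact ⟨hmem i hi j (Nat.le_trans hj (hlen i)), hle i hi h0 j hj⟩
  · ext ⟨k, A, k'⟩
    simp only [Set.mem_iUnion]
    rw [mem_down_edges_iff]
    constructor
    · rintro ⟨he, hkn⟩
      simp only [hedges, Set.mem_iUnion] at he
      obtain ⟨i, hi, j, hj, hje⟩ := he
      obtain ⟨rfl, rfl, rfl⟩ : k = _ ∧ A = _ ∧ k' = _ := by simpa using hje
      exact ⟨i, ⟨hi, (hmono i hi 0 _ (Nat.zero_le _) hj).trans hkn⟩, j,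
        Nat.le_findGreatest (P := fun j => t.le ((r i).node j) n) hj hkn, rfl⟩
    · rintro ⟨i, ⟨hi, h0⟩, j, hj, hje⟩
      obtain ⟨rfl, rfl, rfl⟩ : k = _ ∧ A = _ ∧ k' = _ := by simpa using hje
      refine ⟨?_, hle i hi h0 _ hj⟩
      rw [hedges]
      exact Set.mem_biUnion hi ⟨j, lt_of_lt_of_le hj (hlen i), rfl⟩

/-- The nodes below a given one form a global trace. -/
theorem down_isGlobal {n : Node N X V} (hn : n ∈ t.nodes) : (t.down n).IsGlobal p sem z where
  raw := h.down_raw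
  enabled m A k he := by
    rw [h.down_lockset (h.edge_spec he.1).1 he.2.1]
    exact h.enabled m A k he.1
  init := ⟨⟨h.init.1, h.least n hn⟩, h.init.2⟩
  least k hk := down_le_of_le (h.least k hk.1) hk.2
  antisymm m k hmk hkm := h.antisymm m k (le_of_down_le hmk) (le_of_down_le hkm)
  created_dom m s hc := by
    obtain ⟨h1, h2, h3, h4, h5, h6, h7⟩ := h.created_dom m s hc.1
    refine ⟨⟨h1, hc.2.1⟩, ⟨h2, hc.2.2⟩, h3, h4, h5, fun A k he => h6 A k he.1, ?_⟩
    rw [down_down hc.2.1]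
    exact h7
  created_unique s hs h0 hz := by
    obtain ⟨m, hm, hu⟩ := h.created_unique s hs.1 h0 hz
    exact ⟨m, ⟨hm, (le_of_created hm).trans hs.2, hs.2⟩, fun m' hm' => hu m' hm'.1⟩
  created_inj m s s' hs hs' := h.created_inj m s s' hs.1 hs'.1
  create_val m x v k he := by
    rw [down_down he.2.1]
    exact h.create_val m x v k he.1
  locked_dom a m k hl := by
    obtain ⟨h1, l, hk⟩ := h.locked_dom a m k hl.1
    refine ⟨h1.imp_right ?_, l, mem_down_edges_iff.2 ⟨hk, hl.2.2⟩⟩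
    rintro ⟨l', hl'⟩
    exact ⟨l', mem_down_edges_iff.2 ⟨hl', hl.2.1⟩⟩
  locked_unique a k k' he := by
    obtain ⟨m, hm, hu⟩ := h.locked_unique a k k' he.1
    exact ⟨m, ⟨hm, (le_of_locked hm).trans he.2.2, he.2.2⟩, fun m' hm' => hu m' hm'.1⟩
  locked_inj a m k k' hk hk' := h.locked_inj a m k k' hk.1 hk'.1
  read_val m x g k he := by
    obtain ⟨l, y, l', hl, hle, hmax, hval⟩ := h.read_val m x g k he.1
    exact ⟨l, y, l', mem_down_edges_iff.2 ⟨hl, hle.trans he.2.1⟩, down_le_of_le hle he.2.1,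
      fun w y' w' hw hwm hlw => hmax w y' w' hw.1 (le_of_down_le hwm) (le_of_down_le hlw), hval⟩

theorem lastWriteAt_unique {n : Node N X V} {g : G} {m m' k k' : Node N X V} {x x' : X}
    (hw : LastWriteAt p t n g m x k) (hw' : LastWriteAt p t n g m' x' k') :
    m = m' ∧ x = x' ∧ k = k' := by
  obtain ⟨he, hs, hi, hmax⟩ := hw
  obtain ⟨he', hs', hi', hmax'⟩ := hw'
  obtain rfl : k = k' := h.node_ext (h.edge_spec he).2.1 (h.edge_spec he').2.1 (hs.trans hs'.symm)
    (le_antisymm (hmax' _ _ _ he hs hi) (hmax _ _ _ he' hs' hi'))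
  obtain ⟨rfl, hA⟩ := h.edge_unique he he'
  exact ⟨rfl, by injection hA, rfl⟩

theorem lastWriteAt_step {m s : Node N X V} {A : Action N X G M L} (he : (m, A, s) ∈ t.edges)
    {g : G} (hA : ∀ x, A ≠ .write g x) {w k : Node N X V} {x : X} :
    LastWriteAt p t s g w x k ↔ LastWriteAt p t m g w x k := by
  obtain ⟨hm, hsn, hi, hs, -⟩ := h.edge_spec he
  have hlt : ∀ {l y l'}, (l, Action.write g y, l') ∈ t.edges → l'.st p.self = s.st p.self →
      l'.idx ≤ s.idx → l'.idx ≤ m.idx := by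
    intro l y l' hl hls hli
    by_contra hlt
    obtain rfl := h.node_ext (h.edge_spec hl).2.1 hsn hls (by omega)
    exact hA y (h.edge_unique he hl).2
  constructor
  · rintro ⟨h1, h2, h3, h4⟩
    exact ⟨h1, h2.trans hs.symm, hlt h1 h2 h3, fun l y l' hl hls hli =>
      h4 l y l' hl (hls.trans hs) (by omega)⟩
  · rintro ⟨h1, h2, h3, h4⟩
    exact ⟨h1, h2.trans hs, by omega, fun l y l' hl hls hli =>
      h4 l y l' hl (hls.trans hs.symm) (hlt hl hls hli)⟩

end IsGlobal

end Trace

/-! ### Description of nodes by states of Protection-Based Reading -/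

section DescribedAt

variable {N X G M L V D : Type u} {p : Program N X G M L}
  {sem : Semantics N X G M L V} {t : Trace N X G M L V} {z : Node N X V}

/-- The local trace ending in the node `n` of `t` is described by `q`. -/
structure DescribedAt (p : Program N X G M L) (prot : G → Set M) (conc : D → Set V)
    (t : Trace N X G M L V) (n : Node N X V) (q : PState X G D) : Prop where
  locals : ∀ x, n.st x ∈ conc (q.2 (Sum.inl x))
  globals : ∀ g m x k, t.LastWriteAt p n g m x k → m.st x ∈ conc (q.2 (Sum.inr g))
  held : ∀ g ∈ OrderDual.ofDual q.1, ∃ m x k, t.LastWriteAt p n g m x k ∧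
    ∀ l ∈ t.nodes, l.st p.self = n.st p.self → k.idx ≤ l.idx → l.idx ≤ n.idx →
      (t.lockset p l ∩ prot g).Nonempty

theorem DescribedAt.mono [Preorder D] {prot : G → Set M} {conc : D → Set V} (hconc : Monotone conc)
    {n : Node N X V} {q q' : PState X G D}
    (hd : DescribedAt p prot conc t n q) (hq : q ≤ q') : DescribedAt p prot conc t n q' :=
  ⟨fun x => hconc (hq.2 _) (hd.locals x), fun g m x k hw => hconc (hq.2 _) (hd.globals g m x k hw),
    fun g hg => hd.held g (hq.1 hg)⟩

/-- Passes from the description of a node inside `t` to the concretization of local traces, as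
required by `nu_sound` and by the final claim. -/
theorem DescribedAt.down_mem_gammaAt {prot : G → Set M} (hprot : p.WriteProtects prot)
    {conc : D → Set V} (h : t.IsGlobal p sem z) {n : Node N X V} (hn : n ∈ t.nodes)
    {q : PState X G D} (hd : DescribedAt p prot conc t n q) :
    t.down n ∈ gammaAt p sem conc n.pt (t.lockset p n) (gammaState prot q) := by
  have hsink := Trace.isSink_down hn
  refine ⟨⟨⟨z, h.down_isGlobal hn⟩, n, hsink⟩, n, hsink, rfl, h.down_lockset hn (Trace.le_refl n),
    fun g => upLocks_le_iff.2 ?_, fun g => upLocks_le_iff.2 ?_, ?_⟩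
  · rintro _ ⟨m, x, k, hw, rfl⟩
    have he := hw.1.1
    obtain ⟨hm, hk, -, -, hpe, -⟩ := h.edge_spec he
    rw [h.down_lockset hk hw.1.2.2, h.lockset_step he]
    exact upMem_upLocks.2 ⟨prot g, rfl, hprot.2 _ _ _ _ _ (h.reach hm) hpe⟩
  · rintro _ (⟨m, x, k, hw, l, hl, hs, hi, rfl⟩ | ⟨hno, rfl⟩)
    · refine upMem_gammaState.2 fun hg => ?_
      obtain ⟨m', x', k', hw', hl'⟩ := hd.held g hg
      obtain ⟨-, -, rfl⟩ := h.lastWriteAt_unique ((h.down_isLastWrite_iff hn).1 hw) hw'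
      rw [h.down_lockset hl.1 hl.2]
      exact hl' l hl.1 hs hi (h.idx_le_of_le hl.1 hn hs hl.2)
    · refine upMem_gammaState.2 fun hg => ?_
      obtain ⟨m', x', k', hw', -⟩ := hd.held g hg
      exact absurd ⟨m', x', k', (h.down_isLastWrite_iff hn).2 hw'⟩ hno
  · rintro (x | g)
    · rintro _ rfl
      exact hd.locals x
    · rintro _ ⟨m, x, k, hw, rfl⟩
      exact hd.globals g m x k ((h.down_isLastWrite_iff hn).1 hw)

end DescribedAt
/-! ### Soundness of Protection-Based Reading -/

/-- `(k, g = y, k')` is a write to `g` which is maximal among those before `m`. -/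
def Trace.MaxWrite {N X G M L V : Type u} (t : Trace N X G M L V) (m : Node N X V) (g : G)
    (k : Node N X V) (y : X) (k' : Node N X V) : Prop :=
  (k, Action.write g y, k') ∈ t.edges ∧ t.le k' m ∧
    ∀ l y' l', (l, Action.write g y', l') ∈ t.edges → t.le l' m → t.le k' l' → l' = k'

namespace Trace.IsGlobal

variable {N X G M L V : Type u} {p : Program N X G M L} {sem : Semantics N X G M L V}
  {t : Trace N X G M L V} {z : Node N X V} {prot : G → Set M}

/-- Mutual exclusion with the order of `c` and `d` known: a release after `d` but before `c` would
contradict `c ≤ d`. -/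
theorem exists_unlock_of_le (h : t.IsGlobal p sem z) {a : M} {c d : Node N X V} (hc : c ∈ t.nodes)
    (hd : d ∈ t.nodes) (hcd : c.st p.self ≠ d.st p.self) (hac : a ∈ t.lockset p c)
    (had : a ∈ t.lockset p d) (hle : t.le c d) :
    ∃ k q, (k, Action.unlock a, q) ∈ t.edges ∧ q.st p.self = c.st p.self ∧ c.idx < q.idx ∧
      t.le q d := by
  rcases h.exists_unlock_of_mem_lockset hc hd hcd hac had with hq | ⟨k, q, hq, hs, hi, hqc⟩
  · exact hq
  · have := h.idx_le_of_le (h.edge_spec hq).2.1 hd hs (hqc.trans hle)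
    omega

theorem subset_lockset_of_write (h : t.IsGlobal p sem z) (hprot : p.WriteProtects prot)
    {m n : Node N X V} {g : G} {x : X} (he : (m, Action.write g x, n) ∈ t.edges) :
    prot g ⊆ t.lockset p n := by
  obtain ⟨hm, -, -, -, hpe, -⟩ := h.edge_spec he
  rw [h.lockset_step he]
  exact hprot.2 _ _ _ _ _ (h.reach hm) hpe

theorem lastWriteAt_of_maxWrite (h : t.IsGlobal p sem z) {m k k' n : Node N X V} {g : G} {y : X}
    (hk : t.MaxWrite m g k y k') (hn : n ∈ t.nodes) (hnm : t.le n m)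
    (hs : k'.st p.self = n.st p.self) (hi : k'.idx ≤ n.idx) : LastWriteAt p t n g k y k' := by
  refine ⟨hk.1, hs, hi, fun l y' l' hl hls hli => ?_⟩
  by_contra hlt
  have hl' := (h.edge_spec hl).2.1
  have := hk.2.2 l y' l' hl ((h.le_of_idx_le hl' hn hls hli).trans hnm)
    (h.le_of_idx_le (h.edge_spec hk.1).2.1 hl' (hs.trans hls.symm) (by omega))
  subst this
  exact hlt le_rfl

/-- If a thread has always held some mutex protecting `g` since its last write to `g`, then no
other thread has written to `g` since then. -/
theorem self_eq_of_held (h : t.IsGlobal p sem z) (hprot : p.WriteProtects prot)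
    {m k k' e e' : Node N X V} {g : G} {x y : X} (hm : m ∈ t.nodes)
    (hk : t.MaxWrite m g k y k') (he : LastWriteAt p t m g e x e')
    (hheld : ∀ l ∈ t.nodes, l.st p.self = m.st p.self → e'.idx ≤ l.idx → l.idx ≤ m.idx →
      (t.lockset p l ∩ prot g).Nonempty) : k'.st p.self = m.st p.self := by
  by_contra hne
  have hk'n := (h.edge_spec hk.1).2.1
  have he'n := (h.edge_spec he.1).2.1
  have hk'p := h.subset_lockset_of_write hprot hk.1
  have he'p := h.subset_lockset_of_write hprot he.1
  have he'm : t.le e' m := h.le_of_idx_le he'n hm he.2.1 he.2.2.1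
  have hne' : e'.st p.self ≠ k'.st p.self := fun hh => hne (hh.symm.trans he.2.1)
  -- Both writes hold `mtx g`, so they are ordered. If `k'` came first, its maximality would
  -- identify the two nodes.
  have hle : t.le e' k' := by
    rcases h.exists_unlock_of_mem_lockset he'n hk'n hne' (he'p (hprot.1 g)) (hk'p (hprot.1 g)) with
      ⟨l, q, hq, hs, hi, hqd⟩ | ⟨l, q, hq, hs, hi, hqd⟩
    · exact (h.le_of_idx_le he'n (h.edge_spec hq).2.1 hs.symm hi.le).trans hqd
    · have hke : t.le k' e' := (h.le_of_idx_le hk'n (h.edge_spec hq).2.1 hs.symm hi.le).trans hqd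
      exact absurd (congrArg (fun n => n.st p.self) (hk.2.2 e x e' he.1 he'm hke)) hne'
  -- Take the last node `c` of the reading thread below the foreign write. A protecting mutex held
  -- at `c` is also held at `k'`, so the reading thread releases it in between, at a later node
  -- below `k'`.
  obtain ⟨c, ⟨hc, hcs, hck⟩, hmax⟩ := Set.exists_max_image
    {c | c ∈ t.nodes ∧ c.st p.self = m.st p.self ∧ t.le c k'} Node.idx
    (h.finite_nodes.subset (Set.sep_subset _ _)) ⟨e', he'n, he.2.1, hle⟩
  obtain ⟨b, hbc, hb⟩ := hheld c hc hcs (hmax e' ⟨he'n, he.2.1, hle⟩)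
    (h.idx_le_of_le hc hm hcs (hck.trans hk.2.1))
  obtain ⟨l, q, hq, hs, hi, hqk⟩ := h.exists_unlock_of_le hc hk'n
    (fun hh => hne (hh.symm.trans hcs)) hbc (hk'p hb) hck
  have := hmax q ⟨(h.edge_spec hq).2.1, hs.trans hcs, hqk⟩
  omega

end Trace.IsGlobal

section Soundness

variable {N X G M L V D : Type u} {p : Program N X G M L}
  {sem : Semantics N X G M L V} {t : Trace N X G M L V} {z : Node N X V} {prot : G → Set M}
  {conc : D → Set V}

theorem DescribedAt.lockset_inter_nonempty {n : Node N X V} {q : PState X G D}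
    (hd : DescribedAt p prot conc t n q) (hn : n ∈ t.nodes) {g : G}
    (hg : g ∈ OrderDual.ofDual q.1) : (t.lockset p n ∩ prot g).Nonempty := by
  obtain ⟨m, x, k, hw, hheld⟩ := hd.held g hg
  exact hheld n hn rfl hw.2.2.1 le_rfl

/-- Common part of all actions other than writes: last writes are unchanged, and only the new node
must be checked for still holding a protecting mutex. -/
theorem DescribedAt.step (h : t.IsGlobal p sem z) {m s : Node N X V} {A : Action N X G M L}
    (he : (m, A, s) ∈ t.edges) (hA : ∀ g x, A ≠ .write g x) {q q' : PState X G D}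
    (hd : DescribedAt p prot conc t m q) (hP : OrderDual.ofDual q'.1 ⊆ OrderDual.ofDual q.1)
    (hS : ∀ g ∈ OrderDual.ofDual q'.1, (t.lockset p s ∩ prot g).Nonempty)
    (hX : ∀ x, s.st x ∈ conc (q'.2 (Sum.inl x)))
    (hG : ∀ g, q'.2 (Sum.inr g) = q.2 (Sum.inr g)) : DescribedAt p prot conc t s q' := by
  obtain ⟨hm, hsn, hi, hs, -⟩ := h.edge_spec he
  refine ⟨hX, fun g w x k hw => ?_, fun g hg => ?_⟩
  · rw [hG]
    exact hd.globals g w x k ((h.lastWriteAt_step he (hA g)).1 hw)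
  · obtain ⟨w, x, k, hw, hheld⟩ := hd.held g (hP hg)
    refine ⟨w, x, k, (h.lastWriteAt_step he (hA g)).2 hw, fun l hl hls hkl hli => ?_⟩
    by_cases hls' : l.idx = s.idx
    · obtain rfl := h.node_ext hl hsn hls hls'
      exact hS g hg
    · exact hheld l hl (hls.trans hs.symm) hkl (by omega)

theorem DescribedAt.write [Preorder D] (hconc : Monotone conc) (h : t.IsGlobal p sem z) (hprot : p.WriteProtects prot)
    {m s : Node N X V} {g : G} {x : X} (he : (m, Action.write g x, s) ∈ t.edges)
    {q : PState X G D} (hd : DescribedAt p prot conc t m q) :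
    DescribedAt p prot conc t s (OrderDual.toDual (OrderDual.ofDual q.1 ∪ {g}),
      override q.2 (Sum.inr g) (q.2 (Sum.inl x))) := by
  obtain ⟨hm, hsn, hi, hs, -, hst⟩ := h.edge_spec he
  have hst : s.st = m.st := hst
  have hlast := Trace.lastWriteAt_of_write (p := p) he
  have hA : ∀ {g'}, g' ≠ g → ∀ y, (Action.write g x : Action N X G M L) ≠ .write g' y := by
    intro g' hg' y hy
    injection hy with hy
    exact hg' hy.symm
  refine ⟨fun y => ?_, fun g' w y k hw => ?_, fun g' hg' => ?_⟩
  · rw [hst]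
    exact Set.mem_of_mem_of_subset (hd.locals y) (hconc (override_of_ne (by simp)).ge)
  · by_cases hgg : g' = g
    · subst hgg
      obtain ⟨rfl, rfl, rfl⟩ := h.lastWriteAt_unique hw hlast
      exact Set.mem_of_mem_of_subset (hd.locals y) (hconc (override_same _ _ _).ge)
    · exact Set.mem_of_mem_of_subset
        (hd.globals g' w y k ((h.lastWriteAt_step he (hA hgg)).1 hw))
        (hconc (override_of_ne (by simpa using hgg)).ge)
  · by_cases hgg : g' = g
    · subst hgg
      refine ⟨m, x, s, hlast, fun l hl hls hsl hli => ?_⟩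
      obtain rfl := h.node_ext hl hsn hls (le_antisymm hli hsl)
      exact ⟨p.mtx g', h.subset_lockset_of_write hprot he (hprot.1 g'), hprot.1 g'⟩
    · have hg'' : g' ∈ OrderDual.ofDual q.1 := hg'.resolve_right hgg
      obtain ⟨w, y, k, hw, hheld⟩ := hd.held g' hg''
      refine ⟨w, y, k, (h.lastWriteAt_step he (hA hgg)).2 hw, fun l hl hls hkl hli => ?_⟩
      by_cases hls' : l.idx = s.idx
      · obtain rfl := h.node_ext hl hsn hls hls'
        rw [h.lockset_step he]
        exact hd.lockset_inter_nonempty hm hg''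
      · exact hheld l hl (hls.trans hs.symm) hkl (by omega)

theorem childStore_inl [CompleteLattice D] {self : X} {σ : Store X G D} {i : D} {x : X} :
    childStore self σ i (Sum.inl x) = override (fun x => σ (Sum.inl x)) self i x := rfl

/-- A node without predecessor in its thread is described by a state without information about
globals which describes its locals. -/
theorem DescribedAt.of_idx_zero (h : t.IsGlobal p sem z) {n : Node N X V} (h0 : n.idx = 0)
    {σ : Store X G D} (hX : ∀ x, n.st x ∈ conc (σ (Sum.inl x))) :
    DescribedAt p prot conc t n (OrderDual.toDual ∅, σ) := by
  refine ⟨hX, fun g m x k hw => ?_, fun g hg => absurd hg (Set.notMem_empty g)⟩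
  have h1 := (h.edge_spec hw.1).2.2.1
  have h2 := hw.2.2.1
  omega

variable [CompleteLattice D] {comp : L → (X → D) → (X → D)} {nu : N → PState X G D → N → D} {η : PAssign N X G M D}

-- An own write is covered by the local copy. A foreign write rules out `g ∈ P` and must have been
-- published at an unlock of the writing thread before the read.
open scoped Classical in
theorem read_mem_conc (hatomic : p.Atomic) (hprot : p.WriteProtects prot)
    (hη : IsSolution (C₁' p prot comp nu) η) (hconc : Monotone conc) (h : t.IsGlobal p sem z)
    {m s : Node N X V} {x : X} {g : G} (he : (m, Action.read x g, s) ∈ t.edges)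
    (ih : ∀ n ∈ t.nodes, t.le n m →
      DescribedAt p prot conc t n (η (.pt n.pt (t.lockset p n)))) {q : PState X G D}
    (hq : η (.pt m.pt (t.lockset p m)) = q) :
    s.st x ∈ conc (if g ∈ OrderDual.ofDual q.1 then q.2 (Sum.inr g)
      else if t.lockset p m ∩ prot g = {p.mtx g} then q.2 (Sum.inr g) ⊔ η (.glob' g)
      else q.2 (Sum.inr g) ⊔ η (.glob g)) := by
  obtain ⟨k, y, k', hk1, hk2, hk3, hval⟩ := h.read_val _ _ _ _ he
  have hk : t.MaxWrite m g k y k' := ⟨hk1, hk2, hk3⟩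
  rw [hval]
  obtain ⟨hm, -, -, -, hpe, -⟩ := h.edge_spec he
  obtain ⟨-, hk'n, -, -, hpk, -⟩ := h.edge_spec hk1
  have hdm := ih m hm (Trace.le_refl m)
  rw [hq] at hdm
  have hmg : p.mtx g ∈ t.lockset p m :=
    (h.reach hm).mtx_mem_of_accesses hatomic hpe (Or.inr ⟨x, rfl⟩)
  have hkp := h.subset_lockset_of_write hprot hk1
  have hunlock : ∀ {l b q}, (l, Action.unlock b, q) ∈ t.edges →
      ∀ e ∈ unlockEff' p prot (t.lockset p l) b (η (.pt l.pt (t.lockset p l))).2,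
        e.2 ≤ η e.1 := by
    intro l b q he
    obtain ⟨hl, -, -, -, hpe, -⟩ := h.edge_spec he
    exact ((isSolution_pSystem_iff.1 hη).2 _ _ _ _ (h.reach hl) hpe (h.enabled _ _ _ he)).1
  by_cases hself : k'.st p.self = m.st p.self
  · have hv := hdm.globals g k y k' (h.lastWriteAt_of_maxWrite hk hm (Trace.le_refl m) hself
      (h.idx_le_of_le hk'n hm hself hk2))
    refine hconc ?_ hv
    split_ifs
    · exact le_rfl
    · exact le_sup_left
    · exact le_sup_left
  have hgP : g ∉ OrderDual.ofDual q.1 := by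
    intro hg
    obtain ⟨e, x', e', hw, hheld⟩ := hdm.held g hg
    exact hself (h.self_eq_of_held hprot hm hk hw hheld)
  rw [if_neg hgP]
  split_ifs with hS
  · refine hconc le_sup_right ?_
    -- Reader and writer both hold `mtx g`, so the writer takes a further step after `k'`. By
    -- atomicity the next one is `unlock (mtx g)`, which publishes the written value to `[g]'`.
    obtain ⟨l, q', hq', hs, hi, -⟩ :=
      h.exists_unlock_of_le hk'n hm hself (hkp (hprot.1 g)) hmg hk2
    obtain ⟨A, k'', he', -⟩ := h.exists_edge_from hk'n (h.edge_spec hq').2.1 hs.symm hi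
    obtain rfl := hatomic.after _ _ _ g hpk (Or.inl ⟨y, rfl⟩) _ _ (h.edge_spec he').2.2.2.2.1
    refine hconc ((unlockEff'_bounded.1 (hunlock he')).2.2 g (Or.inl ⟨g, rfl⟩)) ?_
    exact (ih k' hk'n hk2).globals g k y k' (Trace.lastWriteAt_of_write hk1)
  · refine hconc le_sup_right ?_
    obtain ⟨b, ⟨hbm, hb⟩, hbg⟩ : ∃ b ∈ t.lockset p m ∩ prot g, b ≠ p.mtx g := by
      by_contra! hall
      exact hS (Set.eq_singleton_iff_unique_mem.2 ⟨⟨hmg, hprot.1 g⟩, hall⟩)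
    obtain ⟨l, q', hq', hs, hi, hle⟩ := h.exists_unlock_of_le hk'n hm hself (hkp hb) hbm hk2
    obtain ⟨hl, -, hli, hls, -⟩ := h.edge_spec hq'
    -- The writer has released the common mutex `b ≠ mtx g`, so `g` is not totally protected
    -- afterwards, and `C₁'` sends the copy to `[g]`. No write to `g` intervenes, by maximality of
    -- `k'`.
    refine hconc ((unlockEff'_bounded.1 (hunlock hq')).1 g fun hsub => (hsub ⟨hb, hbg⟩).2 rfl) ?_
    have hlm := (Trace.le_of_edge hq').trans hle
    exact (ih l hl hlm).globals g k y k'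
      (h.lastWriteAt_of_maxWrite hk hl hlm (hs.symm.trans hls.symm) (by omega))

/-- Each node of a global trace is described by the value of its unknown. -/
theorem describedAt (hatomic : p.Atomic) (hprot : p.WriteProtects prot)
    (hη : IsSolution (C₁' p prot comp nu) η) (hs : SoundIngredients p sem prot conc comp nu)
    (h : t.IsGlobal p sem z) : ∀ n ∈ t.nodes,
      DescribedAt p prot conc t n (η (.pt n.pt (t.lockset p n))) := by
  have hsol := isSolution_pSystem_iff.1 hη
  have hconc := hs.conc_mono
  refine h.node_induction fun s hsn ih => ?_
  by_cases h0 : s.idx = 0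
  · rw [h.lockset_of_idx_zero h0]
    by_cases hz : s = z
    · rw [hz, h.init.2.2.1, ← hz]
      refine (DescribedAt.of_idx_zero h h0 (σ := initStore X G) fun x => ?_).mono hconc hsol.1
      change s.st x ∈ conc ⊤
      rw [hs.conc_top]
      trivial
    · obtain ⟨m, hm, -⟩ := h.created_unique s hsn h0 hz
      obtain ⟨hmn, -, -, -, ⟨x, v, he⟩, -, hst⟩ := h.created_dom m s hm
      have hd := ih m hmn (Trace.le_of_created hm) (h.created_ne hm)
      have hnew := hs.nu_sound _ _ _ _ _ _ he _ (hd.down_mem_gammaAt hprot h hmn)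
      -- The creating edge need only exist in the program: the side-effect on the child's start
      -- point is present even if `t` does not take that edge.
      have hle := (hsol.2 _ _ _ _ (h.reach hmn) he trivial).1 _ rfl
      refine (DescribedAt.of_idx_zero h h0 fun y => ?_).mono hconc hle
      rw [hst]
      rw [childStore_inl]
      by_cases hy : y = p.self
      · subst hy
        rw [override_same, override_same]
        exact hnew
      · rw [override_of_ne hy, override_of_ne hy]
        exact hd.locals y
  obtain ⟨m, A, he⟩ := h.exists_edge_to hsn h0
  obtain ⟨hm, -, hi, hself, hpe, hst⟩ := h.edge_spec he
  have hne : m ≠ s := by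
    rintro rfl
    omega
  have hd := ih m hm (Trace.le_of_edge he) hne
  have hle := (hsol.2 _ _ _ _ (h.reach hm) hpe (h.enabled _ _ _ he)).2
  have hS := h.lockset_step he
  rw [hS]
  refine DescribedAt.mono hconc ?_ hle
  cases A with
  | comp l =>
    refine DescribedAt.step h he (by simp) hd subset_rfl (fun g hg => ?_) ?_
      fun g => rfl
    · rw [hS]; exact hd.lockset_inter_nonempty hm hg
    · exact hs.comp_sound l _ _ _ hd.locals hst
  | create x u₁ =>
    refine DescribedAt.step h he (by simp) hd subset_rfl (fun g hg => ?_) (fun y => ?_)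
      fun g => override_of_ne (by simp)
    · rw [hS]; exact hd.lockset_inter_nonempty hm hg
    · rw [h.create_val _ _ _ _ he]
      by_cases hy : y = x
      · subst hy
        rw [override_same]
        exact Set.mem_of_mem_of_subset (hs.nu_sound _ _ _ _ _ _ hpe _
          (hd.down_mem_gammaAt hprot h hm)) (hconc (override_same _ _ _).ge)
      · rw [override_of_ne hy]
        exact Set.mem_of_mem_of_subset (hd.locals y)
          (hconc (override_of_ne (by simpa using hy)).ge)
  | lock a =>
    have hst : s.st = m.st := hst
    refine DescribedAt.step h he (by simp) hd subset_rfl (fun g hg => ?_) (fun y => ?_)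
      fun g => rfl
    · rw [hS]
      exact (hd.lockset_inter_nonempty hm hg).mono
        (Set.inter_subset_inter_left _ Set.subset_union_left)
    · rw [hst]; exact hd.locals y
  | unlock a =>
    have hst : s.st = m.st := hst
    refine DescribedAt.step h he (by simp) hd (fun g hg => hg.1) (fun g hg => ?_) (fun y => ?_)
      fun g => rfl
    · rw [hS]; exact hg.2
    · rw [hst]; exact hd.locals y
  | write g x => exact hd.write hconc h hprot he
  | read x g =>
    obtain ⟨d, hst⟩ : ∃ d, s.st = override m.st x d := hst
    refine DescribedAt.step h he (by simp) hd subset_rfl (fun g hg => ?_) (fun y => ?_)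
      fun g => override_of_ne (by simp)
    · rw [hS]; exact hd.lockset_inter_nonempty hm hg
    · by_cases hy : y = x
      · subst hy
        refine Set.mem_of_mem_of_subset (read_mem_conc hatomic hprot hη hconc h he
          (fun n hn hnm => ih n hn (hnm.trans (Trace.le_of_edge he)) ?_) rfl)
          (hconc (override_same _ _ _).ge)
        rintro rfl
        exact hne (h.antisymm _ _ (Trace.le_of_edge he) hnm)
      · rw [hst, override_of_ne hy]
        refine Set.mem_of_mem_of_subset (hd.locals y) (hconc ?_)
        exact (override_of_ne (by simpa using hy)).ge

/-- A local trace equals the sub-trace below its sink, so the claims at program points are instances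
of `describedAt`. For those at unlocks, the source of the last step is described and its copy of `g`
is side-effected. -/
theorem soundFor_of_isSolution (hatomic : p.Atomic) (hprot : p.WriteProtects prot)
    (hη : IsSolution (C₁' p prot comp nu) η) (hs : SoundIngredients p sem prot conc comp nu) :
    SoundFor p sem prot conc η := by
  have hglob : ∀ g a S w (d : D), (∀ u T, p.Reach u T → S = T \ {a} →
      (∀ e ∈ unlockEff' p prot T a (η (.pt u T)).2, e.2 ≤ η e.1) →
        (η (.pt u T)).2 (Sum.inr g) ≤ d) →
      tracesGlob p sem g a S w ⊆ gammaGlob p sem conc g a S w d := by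
    rintro g a S w d hle t ⟨⟨⟨z, h⟩, hsk⟩, s, hsink, ⟨m, he⟩, hS, hw⟩
    refine ⟨⟨⟨z, h⟩, hsk⟩, s, hsink, ⟨m, he⟩, hS, fun k x n hlast => ⟨?_, hw k x n hlast⟩⟩
    obtain ⟨hm, -, -, -, hpe, -⟩ := h.edge_spec he
    have hd := describedAt hatomic hprot hη hs h m hm
    have hsol := (isSolution_pSystem_iff.1 hη).2 _ _ _ _ (h.reach hm) hpe (h.enabled _ _ _ he)
    have hlast' : (t.down s).IsLastWrite p s g k x n := by rwa [h.down_eq_self hsink]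
    refine hs.conc_mono (hle _ _ (h.reach hm) (hS.symm.trans (h.lockset_step he)) hsol.1) ?_
    exact hd.globals g k x n ((h.lastWriteAt_step he (by simp)).1
      ((h.down_isLastWrite_iff hsink.1).1 hlast'))
  refine ⟨?_, fun g a S w hdesc => hglob g a S w _ ?_, fun g a S w hdesc => hglob g a S w _ ?_⟩
  · rintro u S t ⟨⟨⟨z, h⟩, -⟩, s, hsink, rfl, rfl⟩
    have := (describedAt hatomic hprot hη hs h s hsink.1).down_mem_gammaAt hprot h hsink.1
    rwa [h.down_eq_self hsink] at this
  · rintro u T - rfl hb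
    exact (le_of_unlock_of_describes hb g w).1 hdesc
  · rintro u T - rfl hb
    exact (le_of_unlock_of_describes hb g w).2 hdesc

end Soundness

end ConcurrentAnalysis

/-! ### The main theorem -/

theorem theorem7 {N X G M L D : Type u} [Finite M] [CompleteLattice D]
    (p : ConcurrentAnalysis.Program N X G M L) (prot : G → Set M)
    (comp : L → (X → D) → (X → D))
    (nu₁ : N → ConcurrentAnalysis.PState X G D → N → D)
    (nu₃ : N → ConcurrentAnalysis.WState X G M D → N → D)
    (hatomic : p.Atomic) (hprot : p.WriteProtects prot)
    (hcomp : ∀ l, Monotone (comp l))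
    (hnu₁ : ∀ u u₁, Monotone fun q => nu₁ u q u₁)
    (hnu : ∀ u q u₁, nu₃ u (ConcurrentAnalysis.gammaState prot q) u₁ ≤ nu₁ u q u₁) :
    ∃ η : ConcurrentAnalysis.PAssign N X G M D,
      ConcurrentAnalysis.IsLeastSolution (ConcurrentAnalysis.C₁' p prot comp nu₁) η ∧
      ConcurrentAnalysis.IsLeastSolution (ConcurrentAnalysis.C₁ p prot comp nu₁) η ∧
      (∀ g, (η (.glob g) : D) ≤ η (.glob' g)) ∧
      ConcurrentAnalysis.IsSolution (ConcurrentAnalysis.C₃ p comp nu₃)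
        (ConcurrentAnalysis.eta₃ p prot η) ∧
      (∀ g a S w, ConcurrentAnalysis.Describes p prot (.glob g a S w)
          (.glob' g : ConcurrentAnalysis.PUnk N G M) →
        (ConcurrentAnalysis.eta₃ p prot η (.glob g a S w) : D) ≤ η (.glob' g)) ∧
      (∀ g a S w, ConcurrentAnalysis.Describes p prot (.glob g a S w)
          (.glob g : ConcurrentAnalysis.PUnk N G M) →
        (ConcurrentAnalysis.eta₃ p prot η (.glob g a S w) : D) ≤ η (.glob g)) ∧
      (∀ (V : Type u) (sem : ConcurrentAnalysis.Semantics N X G M L V) (conc : D → Set V),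
        ConcurrentAnalysis.SoundIngredients p sem prot conc comp nu₁ →
        ConcurrentAnalysis.SoundFor p sem prot conc η) := by
  open ConcurrentAnalysis in
  obtain ⟨η, hη⟩ := exists_isLeastSolution (C₁ p prot comp nu₁)
    (pSystem_mono hcomp hnu₁ unlockEff_mono) PVal.exists_isGLB
  have hsol := IsLeastSolution.isSolution_C₁' hatomic hprot hcomp hnu₁ hη
  have hle := IsLeastSolution.glob_le_glob' hatomic hprot hcomp hnu₁ hη
  -- Every solution of `C₁'` solves `C₁`, so the least solution of `C₁`, once it solves `C₁'`, is
  -- least there as well.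
  exact ⟨η, ⟨hsol, fun ζ hζ => hη.2 (IsSolution.isSolution_C₁ hζ)⟩, hη, hle,
    isSolution_eta₃ hatomic hprot hnu hsol hle, fun g a S w => eta₃_le_of_describes_glob',
    fun g a S w => eta₃_le_of_describes_glob,
    fun V sem conc hs => soundFor_of_isSolution hatomic hprot hsol hs⟩
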